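/- Let $n\ge 2$ be an integer, let $\beta$ be the unique positive root of $\beta^n=1+\beta+\cdots+\beta^{n-1}$ (so $1<\beta<2$), and let $\lambda_2$ be a complex root of second largest absolute value, among all $n$ roots, of $p(x)=x^n-(1+x+\cdots+x^{n-1})$. For $x\in[0,1)$ put $t(x)=\beta x-\lfloor\beta x\rfloor$, let $t^m$ be the $m$-th iterate of $t$ ($t^0(x)=x$), and let $x_k=\lfloor\beta t^{k-1}(x)\rfloor$, $k\ge1$, be the digits of the greedy base-$\beta$ expansion of $x$. The scaled remainder is $t^m(x)=\sum_{k\ge1}x_{m+k}\beta^{-k}$. For a function $f$ on $[0,1)$ put $$(Tf)(x)=\beta^{-1}\sum_{y\in[0,1),\ t(y)=x}f(y),\qquad x\in[0,1),\qquad f_m=T^mf .$$ Let $$f_\beta(x)=\frac1{D(\beta)}\sum_{j=1}^n\bigl(\beta^j-\beta^{j-1}-\cdots-\beta\bigr)\,\mathbf 1\bigl\{\beta^{-1}+\cdots+\beta^{-(j-1)}\le x<\beta^{-1}+\cdots+\beta^{-j}\bigr\},\qquad 0\le x<1,$$ where $D(\beta)$ is the constant for which $\int_0^1f_\beta(x)\,dx=1$,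 and let $P_\beta(B)=\int_Bf_\beta(x)\,dx$ for Borel sets $B\subseteq[0,1)$. Then $f_\beta$ is a probability density on $[0,1)$ and $P_\beta$ is invariant under $t$. Let $X$ be a random variable with a probability density $f$ concentrated on $[0,1)$, and let $P_m$ be the law of $t^m(X)$. Then $f_m$ is a probability density of $P_m$ for every $m$, and $$\lim_{m\to\infty}\ \sup_{B\subseteq[0,1)\text{ Borel}}|P_m(B)-P_\beta(B)|=0 .$$ Moreover, there are constants $C_1,C_2$ depending only on $n$ such that, for every probability density $f$ on $[0,1)$ and every $L_f$ with $|f(x)-f(y)|\le L_f|x-y|$ for all $x,y\in[0,1)$, $$\sup_{x\in[0,1)}|f_m(x)-f_\beta(x)|\le C_1\,|\beta^{-1}\lambda_2|^{m_2}+C_2\,\beta^{-m_1}L_f$$ for all integers $m=m_1+m_2$ with $m_2>2n-1$ and $m_1\ge n-1$. -/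

import Mathlib

open Filter Topology MeasureTheory ProbabilityTheory Set

namespace PseudoGolden

noncomputable section

/-- The map `t(x) = βx - ⌊βx⌋`; its `m`-th iterate is the scaled remainder after `m` digits. -/
def betaMap (β x : ℝ) : ℝ := β * x - (⌊β * x⌋ : ℝ)

/-- The digits of the greedy base-`β` expansion, numbered from `0`:
`digit β k x = ⌊β t^k(x)⌋` is the digit multiplying `β^{-(k+1)}`. -/
def digit (β : ℝ) (k : ℕ) (x : ℝ) : ℤ := ⌊β * (betaMap β)^[k] x⌋

/-- `f` is (the restriction to `[0,1)` of) a probability density concentrated on `[0,1)`.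
Values of `f` outside `[0,1)` are irrelevant. -/
structure IsPDF (f : ℝ → ℝ) : Prop where
  measurable : Measurable f
  nonneg : ∀ x ∈ Ico (0 : ℝ) 1, 0 ≤ f x
  lintegral_eq_one : ∫⁻ x in Ico (0 : ℝ) 1, ENNReal.ofReal (f x) = 1

/-- The law `B ↦ ∫_{B ∩ [0,1)} f(x) dx` with density `f` on `[0,1)`. -/
def densityLaw (f : ℝ → ℝ) : Measure ℝ :=
  (volume.restrict (Ico (0 : ℝ) 1)).withDensity fun x => ENNReal.ofReal (f x)

/-- The operator `T` induced by `t` on densities on `[0,1)`, for `1 < β < 2`: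
`(Tf)(x) = β⁻¹ ∑ f(y)`, the sum being over the `y ∈ [0,1)` with `t(y) = x`,
that is, over those `y = (x + k) / β` with `k ∈ {0, 1}` that are less than `1`. -/
def transfer (β : ℝ) (f : ℝ → ℝ) (x : ℝ) : ℝ :=
  β⁻¹ * ∑ k ∈ Finset.range 2, if (x + k) / β < 1 then f ((x + k) / β) else 0

/-- The unnormalized density `∑_{j=1}^n F_j`, where
`F_j = (β^j - β^{j-1} - ⋯ - β) χ_{[β⁻¹ + ⋯ + β^{-(j-1)}, β⁻¹ + ⋯ + β^{-j})}`. -/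
def parrySum (n : ℕ) (β x : ℝ) : ℝ :=
  ∑ j ∈ Finset.Icc 1 n,
    (Ico (∑ i ∈ Finset.Ico 1 j, (β ^ i)⁻¹) (∑ i ∈ Finset.Icc 1 j, (β ^ i)⁻¹)).indicator
      (fun _ => β ^ j - ∑ i ∈ Finset.Ico 1 j, β ^ i) x

/-- The normalizing constant `D(β)`. -/
def parryConst (n : ℕ) (β : ℝ) : ℝ := ∫ x in Ico (0 : ℝ) 1, parrySum n β x

/-- The density `f_β`. -/
def parryDensity (n : ℕ) (β x : ℝ) : ℝ := parrySum n β x / parryConst n β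

/-- The total variation distance of two probability measures on `[0,1)`. -/
def tvDist (μ ν : Measure ℝ) : ℝ :=
  sSup {d | ∃ B : Set ℝ, MeasurableSet B ∧ B ⊆ Ico 0 1 ∧ d = |μ.real B - ν.real B|}

open Polynomial in
/-- The polynomial `x^n - (1 + x + ⋯ + x^{n-1})`. -/
def charPoly (n : ℕ) : ℂ[X] := X ^ n - ∑ i ∈ Finset.range n, X ^ i

/-- `z` is a root of second largest absolute value: it comes second in some enumeration of the
`n` complex roots, with multiplicity, by non-increasing absolute value. -/
def IsSecondRoot (n : ℕ) (z : ℂ) : Prop :=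
  ∃ r : Fin n → ℂ, (charPoly n).roots = Finset.univ.val.map r ∧
    Antitone (fun i => ‖r i‖) ∧ ∃ h : 1 < n, z = r ⟨1, h⟩

end

end PseudoGolden

open PseudoGolden

/-!
The points `β⁻¹ + ⋯ + β⁻ʲ` cut `[0, 1)` into `n` cells. A point `x` of the cell `j` (numbered from
`0`) has the preimage `x / β` in the cell `0` and, if `j + 1 < n`, the preimage `(x + 1) / β` in
the cell `j + 1`. Hence `T` maps the step function with values `v j` to the one with values
`β⁻¹ (v 0 + v (j + 1))`, where `v n = 0`, and the functionals `v ↦ ∑ j, z⁻¹ ^ (j + 1) * v j`, for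
the roots `z` of `p`, are eigenfunctionals of the map on values. The roots are simple, so a
Vandermonde matrix diagonalizes this map. The functional for `z = β` is the integral, and all other
roots are smaller than `β` in absolute value: the `T ^ m`-image of a step function with integral
zero is `O(|λ₂ / β| ^ m)`.

For general `f`, measure the oscillation inside the cells in units of the fixed point `f_β`. A
step of `T` does not increase it, while the distances over which it is taken grow by the factor
`β`. After `m₁` steps the oscillation of `f` at scale `β ^ (-m₁)` therefore bounds the distance
from `T ^ m₁ f` to the step function of its cell averages. This gives the rate for Lipschitz
functions and uniform convergence for continuous ones; since `T` contracts the `L¹` norm and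
continuous functions are dense in `L¹`, convergence in `L¹` follows for every density.
-/

namespace PseudoGolden

noncomputable section

section BetaMap

variable {β x : ℝ}

lemma betaMap_mem_Ico (β x : ℝ) : betaMap β x ∈ Ico (0 : ℝ) 1 :=
  ⟨Int.fract_nonneg (β * x), Int.fract_lt_one (β * x)⟩

lemma iterate_betaMap_mem_Ico (hx : x ∈ Ico (0 : ℝ) 1) (m : ℕ) :
    (betaMap β)^[m] x ∈ Ico (0 : ℝ) 1 :=
  MapsTo.iterate (fun y _ => betaMap_mem_Ico β y) m hx

lemma measurable_betaMap (β : ℝ) : Measurable (betaMap β) := by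
  unfold betaMap
  fun_prop

lemma betaMap_add_natCast_div (hβ : β ≠ 0) (hx : x ∈ Ico (0 : ℝ) 1) (k : ℕ) :
    betaMap β ((x + k) / β) = x := by
  rw [betaMap, mul_div_cancel₀ _ hβ, Int.floor_add_natCast, Int.floor_eq_zero_iff.2 hx]
  simp

lemma iterate_betaMap_eq_sum (hβ : β ≠ 0) (x : ℝ) (m N : ℕ) :
    (betaMap β)^[m] x = ∑ k ∈ Finset.range N, (digit β (m + k) x : ℝ) * (β ^ (k + 1))⁻¹ +
      (β ^ N)⁻¹ * (betaMap β)^[m + N] x := by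
  induction N with
  | zero => simp
  | succ N ih =>
    have hstep : (betaMap β)^[m + (N + 1)] x =
        β * (betaMap β)^[m + N] x - (digit β (m + N) x : ℝ) :=
      Function.iterate_succ_apply' (betaMap β) (m + N) x
    rw [ih, Finset.sum_range_succ, hstep]
    field_simp
    ring

lemma hasSum_digit (hβ : 1 < β) (hx : x ∈ Ico (0 : ℝ) 1) (m : ℕ) :
    HasSum (fun k : ℕ => (digit β (m + k) x : ℝ) * (β ^ (k + 1))⁻¹) ((betaMap β)^[m] x) := by
  have hβ₀ : 0 < β := one_pos.trans hβ
  have hmem (k : ℕ) : (betaMap β)^[k] x ∈ Ico (0 : ℝ) 1 := iterate_betaMap_mem_Ico hx k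
  have hnonneg (k : ℕ) : 0 ≤ (digit β (m + k) x : ℝ) * (β ^ (k + 1))⁻¹ :=
    mul_nonneg (Int.cast_nonneg (Int.floor_nonneg.2 (mul_nonneg hβ₀.le (hmem _).1)))
      (inv_pos.2 (pow_pos hβ₀ _)).le
  have hrem : Tendsto (fun N : ℕ => (β ^ N)⁻¹ * (betaMap β)^[m + N] x) atTop (𝓝 0) := by
    refine squeeze_zero (fun N => mul_nonneg (inv_pos.2 (pow_pos hβ₀ N)).le (hmem _).1)
      (fun N => mul_le_of_le_one_right (inv_pos.2 (pow_pos hβ₀ N)).le (hmem _).2.le) ?_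
    exact tendsto_inv_atTop_zero.comp (tendsto_pow_atTop_atTop_of_one_lt hβ)
  rw [hasSum_iff_tendsto_nat_of_nonneg hnonneg]
  have hsum := hrem.const_sub ((betaMap β)^[m] x)
  rw [sub_zero] at hsum
  exact hsum.congr fun N => sub_eq_of_eq_add (iterate_betaMap_eq_sum hβ₀.ne' x m N)

end BetaMap

section Transfer

variable {β x : ℝ} {f g : ℝ → ℝ}

/-- `transfer β` as a linear map, so that its iterates inherit linearity from Mathlib. -/
def transferLinearMap (β : ℝ) : (ℝ → ℝ) →ₗ[ℝ] ℝ → ℝ where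
  toFun := transfer β
  map_add' f g := by
    funext x
    simp only [transfer, Pi.add_apply, ← mul_add, ← Finset.sum_add_distrib]
    congr! 2
    split_ifs <;> simp
  map_smul' c f := by
    funext x
    simp only [transfer, Pi.smul_apply, smul_eq_mul, RingHom.id_apply, mul_left_comm c,
      Finset.mul_sum, mul_ite, mul_zero]

lemma iterate_transfer_sub (β : ℝ) (m : ℕ) (f g : ℝ → ℝ) :
    (transfer β)^[m] (f - g) = (transfer β)^[m] f - (transfer β)^[m] g :=
  iterate_map_sub (transferLinearMap β) m f g

lemma transfer_smul (β c : ℝ) (f : ℝ → ℝ) : transfer β (c • f) = c • transfer β f :=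
  map_smul (transferLinearMap β) c f

lemma iterate_transfer_smul (β c : ℝ) (m : ℕ) (f : ℝ → ℝ) :
    (transfer β)^[m] (c • f) = c • (transfer β)^[m] f :=
  ((show Function.Commute (c • ·) (transfer β) from
    fun f => (transfer_smul β c f).symm).iterate_right m f).symm

lemma measurable_transfer (hf : Measurable f) : Measurable (transfer β f) := by
  refine (Finset.measurable_sum _ fun k _ => ?_).const_mul _
  have hk : Measurable fun x : ℝ => (x + k) / β := by fun_prop
  exact Measurable.ite (measurableSet_lt hk measurable_const) (hf.comp hk) measurable_const

lemma transfer_eq_sum_indicator (hβ : 0 < β) (hx : 0 ≤ x) (f : ℝ → ℝ) :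
    transfer β f x =
      β⁻¹ * ∑ k ∈ Finset.range 2, (Ico (0 : ℝ) 1).indicator f ((x + k) / β) := by
  have hnonneg (k : ℕ) : 0 ≤ (x + k) / β := by positivity
  simp only [transfer, indicator_apply, mem_Ico, hnonneg, true_and]

lemma abs_transfer_le (hβ : 0 < β) (h : ∀ x ∈ Ico (0 : ℝ) 1, |f x| ≤ g x) :
    ∀ x ∈ Ico (0 : ℝ) 1, |transfer β f x| ≤ transfer β g x := by
  intro x hx
  rw [transfer_eq_sum_indicator hβ hx.1, transfer_eq_sum_indicator hβ hx.1, abs_mul,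
    abs_of_pos (inv_pos.2 hβ)]
  gcongr
  refine (Finset.abs_sum_le_sum_abs _ _).trans (Finset.sum_le_sum fun k _ => ?_)
  by_cases hk : (x + k) / β ∈ Ico (0 : ℝ) 1
  · simpa only [indicator_of_mem hk] using h _ hk
  · simp only [indicator_of_notMem hk, abs_zero, le_refl]

lemma transfer_nonneg (hβ : 0 < β) (h : ∀ x ∈ Ico (0 : ℝ) 1, 0 ≤ f x)
    (hx : x ∈ Ico (0 : ℝ) 1) : 0 ≤ transfer β f x :=
  (abs_nonneg _).trans (abs_transfer_le hβ (fun y hy => (abs_of_nonneg (h y hy)).le) x hx)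

lemma abs_iterate_transfer_le (hβ : 0 < β) (h : ∀ x ∈ Ico (0 : ℝ) 1, |f x| ≤ g x) (m : ℕ) :
    ∀ x ∈ Ico (0 : ℝ) 1, |(transfer β)^[m] f x| ≤ (transfer β)^[m] g x := by
  induction m with
  | zero => exact h
  | succ m ih =>
    simp only [Function.iterate_succ_apply']
    exact abs_transfer_le hβ ih

lemma transfer_congr (hβ : 0 < β) (h : EqOn f g (Ico 0 1)) :
    EqOn (transfer β f) (transfer β g) (Ico 0 1) := by
  intro x hx
  rw [transfer_eq_sum_indicator hβ hx.1, transfer_eq_sum_indicator hβ hx.1,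
    indicator_congr h]

lemma iterate_transfer_of_fixed (hβ : 0 < β) (h : EqOn (transfer β f) f (Ico 0 1)) (m : ℕ) :
    EqOn ((transfer β)^[m] f) f (Ico 0 1) := by
  induction m with
  | zero => exact eqOn_refl f _
  | succ m ih =>
    rw [Function.iterate_succ_apply']
    exact (transfer_congr hβ ih).trans h

lemma integrableOn_transfer (hβ : 0 < β) (hf : IntegrableOn f (Ico 0 1)) :
    IntegrableOn (transfer β f) (Ico 0 1) := by
  have hbranch (k : ℕ) : Integrable fun x => (Ico (0 : ℝ) 1).indicator f ((x + k) / β) :=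
    ((hf.integrable_indicator measurableSet_Ico).comp_div hβ.ne').comp_add_right (k : ℝ)
  have hsum := (integrable_finsetSum (Finset.range 2) fun k _ => hbranch k).const_mul β⁻¹
  exact hsum.integrableOn.congr_fun (fun x hx => (transfer_eq_sum_indicator hβ hx.1 f).symm)
    measurableSet_Ico

-- The branches `x ↦ (x + k) / β`, `k < 2`, map `[0, 1)` onto the two halves of `[0, 2 / β)`.
lemma integral_transfer (hβ : 0 < β) (hβ₂ : β ≤ 2) (hf : IntegrableOn f (Ico 0 1)) :
    ∫ x in Ico (0 : ℝ) 1, transfer β f x = ∫ x in Ico (0 : ℝ) 1, f x := by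
  set h : ℝ → ℝ := (Ico (0 : ℝ) 1).indicator f
  have hh : Integrable h := hf.integrable_indicator measurableSet_Ico
  have hbranch (k : ℕ) : ∫ x in Ico (0 : ℝ) 1, h ((x + k) / β) =
      β * ∫ x in (k / β : ℝ)..((k + 1 : ℕ) / β : ℝ), h x := by
    rw [integral_Ico_eq_integral_Ioc, ← intervalIntegral.integral_of_le zero_le_one]
    simp only [add_div, intervalIntegral.integral_comp_div_add _ hβ.ne', smul_eq_mul]
    congr 2
    · ring
    · push_cast; ring
  have htile : ∫ x in (0 : ℝ)..2 / β, h x = ∫ x in Ico (0 : ℝ) 1, f x := by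
    rw [intervalIntegral.integral_of_le (by positivity), ← integral_Ico_eq_integral_Ioc,
      setIntegral_indicator measurableSet_Ico,
      inter_eq_right.2 (Ico_subset_Ico_right ((one_le_div hβ).2 hβ₂))]
  calc ∫ x in Ico (0 : ℝ) 1, transfer β f x
      = ∫ x in Ico (0 : ℝ) 1, β⁻¹ * ∑ k ∈ Finset.range 2, h ((x + k) / β) :=
        setIntegral_congr_fun measurableSet_Ico fun x hx => transfer_eq_sum_indicator hβ hx.1 f
    _ = β⁻¹ * ∑ k ∈ Finset.range 2, β * ∫ x in (k / β : ℝ)..((k + 1 : ℕ) / β : ℝ), h x := by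
        rw [integral_const_mul, integral_finsetSum (f := fun (k : ℕ) x => h ((x + k) / β)) _
          fun k _ => ((hh.comp_div hβ.ne').comp_add_right (k : ℝ)).integrableOn]
        simp only [hbranch]
    _ = ∫ x in (0 : ℝ)..2 / β, h x := by
        rw [← Finset.mul_sum, inv_mul_cancel_left₀ hβ.ne',
          intervalIntegral.sum_integral_adjacent_intervals fun _ _ => hh.intervalIntegrable]
        simp
    _ = ∫ x in Ico (0 : ℝ) 1, f x := htile

lemma integrableOn_iterate_transfer (hβ : 0 < β) (hf : IntegrableOn f (Ico 0 1)) (m : ℕ) :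
    IntegrableOn ((transfer β)^[m] f) (Ico 0 1) := by
  induction m with
  | zero => exact hf
  | succ m ih =>
    rw [Function.iterate_succ_apply']
    exact integrableOn_transfer hβ ih

lemma integral_iterate_transfer (hβ : 0 < β) (hβ₂ : β ≤ 2) (hf : IntegrableOn f (Ico 0 1))
    (m : ℕ) : ∫ x in Ico (0 : ℝ) 1, (transfer β)^[m] f x = ∫ x in Ico (0 : ℝ) 1, f x := by
  induction m with
  | zero => rfl
  | succ m ih =>
    rw [Function.iterate_succ_apply',
      integral_transfer hβ hβ₂ (integrableOn_iterate_transfer hβ hf m), ih]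

lemma integral_abs_iterate_transfer_le (hβ : 0 < β) (hβ₂ : β ≤ 2)
    (hf : IntegrableOn f (Ico 0 1)) (m : ℕ) :
    ∫ x in Ico (0 : ℝ) 1, |(transfer β)^[m] f x| ≤ ∫ x in Ico (0 : ℝ) 1, |f x| :=
  calc ∫ x in Ico (0 : ℝ) 1, |(transfer β)^[m] f x|
      ≤ ∫ x in Ico (0 : ℝ) 1, (transfer β)^[m] (fun y => |f y|) x :=
        setIntegral_mono_on (integrableOn_iterate_transfer hβ hf m).abs
          (integrableOn_iterate_transfer hβ hf.abs m) measurableSet_Ico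
          (abs_iterate_transfer_le hβ (fun _ _ => le_rfl) m)
    _ = ∫ x in Ico (0 : ℝ) 1, |f x| := integral_iterate_transfer hβ hβ₂ hf.abs m

lemma transfer_indicator_preimage (hβ : β ≠ 0) (f : ℝ → ℝ) (B : Set ℝ) :
    EqOn (transfer β ((betaMap β ⁻¹' B).indicator f)) (B.indicator (transfer β f)) (Ico 0 1) := by
  intro x hx
  by_cases hxB : x ∈ B <;> simp [transfer, betaMap_add_natCast_div hβ hx, hxB]

end Transfer

section Density

variable {β : ℝ} {f g : ℝ → ℝ}

namespace IsPDF

lemma ae_nonneg (hf : IsPDF f) : 0 ≤ᵐ[volume.restrict (Ico (0 : ℝ) 1)] f :=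
  (ae_restrict_iff' measurableSet_Ico).2 (ae_of_all _ hf.nonneg)

lemma integrableOn (hf : IsPDF f) : IntegrableOn f (Ico 0 1) := by
  refine ⟨hf.measurable.aestronglyMeasurable, ?_⟩
  rw [hasFiniteIntegral_iff_ofReal hf.ae_nonneg, hf.lintegral_eq_one]
  exact ENNReal.one_lt_top

lemma integral_eq_one (hf : IsPDF f) : ∫ x in Ico (0 : ℝ) 1, f x = 1 := by
  rw [integral_eq_lintegral_of_nonneg_ae hf.ae_nonneg hf.measurable.aestronglyMeasurable,
    hf.lintegral_eq_one, ENNReal.toReal_one]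

lemma integral_abs_eq_one (hf : IsPDF f) : ∫ x in Ico (0 : ℝ) 1, |f x| = 1 :=
  (setIntegral_congr_fun measurableSet_Ico fun x hx => abs_of_nonneg (hf.nonneg x hx)).trans
    hf.integral_eq_one

lemma of_integral_eq_one (hm : Measurable f) (h₀ : ∀ x ∈ Ico (0 : ℝ) 1, 0 ≤ f x)
    (h₁ : ∫ x in Ico (0 : ℝ) 1, f x = 1) : IsPDF f := by
  refine ⟨hm, h₀, ?_⟩
  have hi : IntegrableOn f (Ico 0 1) :=
    .of_integral_ne_zero (h₁.trans_ne one_ne_zero)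
  rw [← ofReal_integral_eq_lintegral_ofReal hi
    ((ae_restrict_iff' measurableSet_Ico).2 (ae_of_all _ h₀)), h₁, ENNReal.ofReal_one]

lemma densityLaw_apply (hf : IsPDF f) {B : Set ℝ} (hB : MeasurableSet B) :
    densityLaw f B = ENNReal.ofReal (∫ x in Ico (0 : ℝ) 1, B.indicator f x) := by
  rw [densityLaw, withDensity_apply _ hB, integral_indicator hB,
    ofReal_integral_eq_lintegral_ofReal (Integrable.restrict hf.integrableOn)
      (ae_restrict_of_ae hf.ae_nonneg)]

lemma densityLaw_real (hf : IsPDF f) {B : Set ℝ} (hB : MeasurableSet B) :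
    (densityLaw f).real B = ∫ x in Ico (0 : ℝ) 1, B.indicator f x := by
  rw [measureReal_def, hf.densityLaw_apply hB, ENNReal.toReal_ofReal]
  exact setIntegral_nonneg measurableSet_Ico fun x hx =>
    indicator_apply_nonneg fun _ => hf.nonneg x hx

lemma tvDist_densityLaw_le (hf : IsPDF f) (hg : IsPDF g) :
    tvDist (densityLaw f) (densityLaw g) ≤ ∫ x in Ico (0 : ℝ) 1, |f x - g x| := by
  refine Real.sSup_le ?_ (integral_nonneg fun _ => abs_nonneg _)
  rintro _ ⟨B, hB, -, rfl⟩
  have hfB := hf.integrableOn.indicator hB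
  have hgB := hg.integrableOn.indicator hB
  rw [hf.densityLaw_real hB, hg.densityLaw_real hB, ← integral_sub hfB hgB]
  refine abs_integral_le_integral_abs.trans (integral_mono (hfB.sub hgB).abs
    (Integrable.sub hf.integrableOn hg.integrableOn).abs fun x => ?_)
  by_cases h : x ∈ B <;> simp [h]

end IsPDF

lemma tvDist_nonneg (μ ν : Measure ℝ) : 0 ≤ tvDist μ ν := by
  refine Real.sSup_nonneg ?_
  rintro _ ⟨B, -, -, rfl⟩
  exact abs_nonneg _

lemma densityLaw_congr (h : EqOn f g (Ico 0 1)) : densityLaw f = densityLaw g :=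
  withDensity_congr_ae ((ae_restrict_iff' measurableSet_Ico).2 (ae_of_all _ fun _ hx =>
    congrArg ENNReal.ofReal (h hx)))

lemma isPDF_transfer (hβ : 0 < β) (hβ₂ : β ≤ 2) (hf : IsPDF f) : IsPDF (transfer β f) :=
  .of_integral_eq_one (measurable_transfer hf.measurable)
    (fun _ hx => transfer_nonneg hβ hf.nonneg hx)
    ((integral_transfer hβ hβ₂ hf.integrableOn).trans hf.integral_eq_one)

lemma isPDF_iterate_transfer (hβ : 0 < β) (hβ₂ : β ≤ 2) (hf : IsPDF f) (m : ℕ) :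
    IsPDF ((transfer β)^[m] f) := by
  induction m with
  | zero => exact hf
  | succ m ih =>
    rw [Function.iterate_succ_apply']
    exact isPDF_transfer hβ hβ₂ ih

lemma measurePreserving_betaMap (hβ : 0 < β) (hβ₂ : β ≤ 2) (hf : IsPDF f) :
    MeasurePreserving (betaMap β) (densityLaw f) (densityLaw (transfer β f)) := by
  refine ⟨measurable_betaMap β, ?_⟩
  ext B hB
  have hB' : MeasurableSet (betaMap β ⁻¹' B) := measurable_betaMap β hB
  rw [Measure.map_apply (measurable_betaMap β) hB, hf.densityLaw_apply hB',
    (isPDF_transfer hβ hβ₂ hf).densityLaw_apply hB,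
    ← integral_transfer hβ hβ₂ (hf.integrableOn.indicator hB'),
    setIntegral_congr_fun measurableSet_Ico (transfer_indicator_preimage hβ.ne' f B)]

lemma measurePreserving_iterate_betaMap (hβ : 0 < β) (hβ₂ : β ≤ 2) (hf : IsPDF f) (m : ℕ) :
    MeasurePreserving (betaMap β)^[m] (densityLaw f) (densityLaw ((transfer β)^[m] f)) := by
  induction m with
  | zero => exact .id _
  | succ m ih =>
    rw [Function.iterate_succ_apply', Function.iterate_succ']
    exact (measurePreserving_betaMap hβ hβ₂ (isPDF_iterate_transfer hβ hβ₂ hf m)).comp ih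

lemma tendsto_tvDist_of_tendsto_integral {F : ℕ → ℝ → ℝ} (hF : ∀ m, IsPDF (F m))
    (hg : IsPDF g)
    (h : Tendsto (fun m => ∫ x in Ico (0 : ℝ) 1, |F m x - g x|) atTop (𝓝 0)) :
    Tendsto (fun m => tvDist (densityLaw (F m)) (densityLaw g)) atTop (𝓝 0) :=
  squeeze_zero (fun _ => tvDist_nonneg _ _) (fun m => (hF m).tvDist_densityLaw_le hg) h

end Density

section RootIdentities

variable {K : Type*} [Field K] {z : K} {n : ℕ}

lemma ne_zero_of_pow_eq_geom_sum (h : z ^ n = ∑ i ∈ Finset.range n, z ^ i) : z ≠ 0 := by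
  rintro rfl
  cases n with
  | zero => simp at h
  | succ n => simp [Finset.sum_range_succ'] at h

lemma pow_mul_sum_inv_pow_succ (hz : z ≠ 0) (n : ℕ) :
    z ^ n * ∑ i ∈ Finset.range n, z⁻¹ ^ (i + 1) = ∑ i ∈ Finset.range n, z ^ i := by
  induction n with
  | zero => simp
  | succ n ih =>
    rw [geom_sum_succ, ← ih, Finset.sum_range_succ, mul_add, ← mul_pow, mul_inv_cancel₀ hz,
      one_pow, pow_succ' z n, mul_assoc]

lemma sum_inv_pow_succ_eq_one (h : z ^ n = ∑ i ∈ Finset.range n, z ^ i) :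
    ∑ i ∈ Finset.range n, z⁻¹ ^ (i + 1) = 1 := by
  have hz := ne_zero_of_pow_eq_geom_sum h
  exact mul_left_cancel₀ (pow_ne_zero n hz)
    ((pow_mul_sum_inv_pow_succ hz n).trans (h.symm.trans (mul_one _).symm))

end RootIdentities

/-- `β` is the `n`-bonacci constant: the positive root of `β ^ n = 1 + β + ⋯ + β ^ (n - 1)`,
where `2 ≤ n`. -/
structure IsMultinacci (n : ℕ) (β : ℝ) : Prop where
  two_le : 2 ≤ n
  pos : 0 < β
  pow_eq : β ^ n = ∑ i ∈ Finset.range n, β ^ i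

/-- The end point `β⁻¹ + ⋯ + β⁻ʲ` of the cells of the Markov partition. -/
def cutPoint (β : ℝ) (j : ℕ) : ℝ := ∑ i ∈ Finset.range j, β⁻¹ ^ (i + 1)

/-- The cells of the Markov partition of `betaMap β`, numbered from `0`: the paper's `j`-th
interval is `cell β (j - 1)`, and `[0, 1)` is the union of the first `n` cells. -/
def cell (β : ℝ) (j : ℕ) : Set ℝ := Ico (cutPoint β j) (cutPoint β (j + 1))

/-- The step function with value `v j` on the `j`-th cell, for `j < n`. -/
def stepFun (n : ℕ) (β : ℝ) (v : ℕ → ℝ) (x : ℝ) : ℝ :=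
  ∑ j ∈ Finset.range n, (cell β j).indicator (fun _ => v j) x

/-- The value of `parrySum` on the `j`-th cell. -/
def parryWeight (β : ℝ) (j : ℕ) : ℝ := β ^ (j + 1) - ∑ i ∈ Finset.range j, β ^ (i + 1)

/-- The action of `β • transfer β` on the values of step functions. -/
def cellTransfer (n : ℕ) (v : ℕ → ℝ) (j : ℕ) : ℝ := v 0 + if j + 1 < n then v (j + 1) else 0

section Cells

variable {n j : ℕ} {β x : ℝ}

@[simp] lemma cutPoint_zero (β : ℝ) : cutPoint β 0 = 0 := by simp [cutPoint]

lemma cutPoint_succ (β : ℝ) (j : ℕ) : cutPoint β (j + 1) = cutPoint β j + β⁻¹ ^ (j + 1) :=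
  Finset.sum_range_succ _ _

lemma mul_cutPoint_succ (hβ : β ≠ 0) (j : ℕ) :
    β * cutPoint β (j + 1) = cutPoint β j + 1 := by
  simp only [cutPoint, Finset.sum_range_succ' _ j, mul_add, Finset.mul_sum, pow_succ' β⁻¹,
    mul_inv_cancel_left₀ hβ, pow_zero, mul_one, mul_inv_cancel₀ hβ]

lemma strictMono_cutPoint (hβ : 0 < β) : StrictMono (cutPoint β) :=
  strictMono_nat_of_lt_succ fun j => by
    rw [cutPoint_succ]
    exact lt_add_of_pos_right _ (pow_pos (inv_pos.2 hβ) _)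

lemma cutPoint_nonneg (hβ : 0 < β) (j : ℕ) : 0 ≤ cutPoint β j := by
  simpa using (strictMono_cutPoint hβ).monotone (Nat.zero_le j)

lemma measurableSet_cell (β : ℝ) (j : ℕ) : MeasurableSet (cell β j) := measurableSet_Ico

lemma volume_real_cell (hβ : 0 < β) (j : ℕ) : volume.real (cell β j) = β⁻¹ ^ (j + 1) := by
  rw [cell, Real.volume_real_Ico_of_le (strictMono_cutPoint hβ j.lt_succ_self).le, cutPoint_succ,
    add_sub_cancel_left]

lemma exists_mem_cell_of_lt_cutPoint (hx : 0 ≤ x) (hxn : x < cutPoint β n) :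
    ∃ j < n, x ∈ cell β j := by
  induction n with
  | zero => exact absurd (hxn.trans_eq (cutPoint_zero β)) hx.not_gt
  | succ n ih =>
    by_cases h : x < cutPoint β n
    · obtain ⟨j, hj, hxj⟩ := ih h
      exact ⟨j, hj.trans n.lt_succ_self, hxj⟩
    · exact ⟨n, n.lt_succ_self, not_lt.1 h, hxn⟩

lemma stepFun_of_mem_cell (hβ : 0 < β) (hj : j < n) (hx : x ∈ cell β j) (v : ℕ → ℝ) :
    stepFun n β v x = v j := by
  have hdisj := (strictMono_cutPoint hβ).monotone.pairwise_disjoint_on_Ico_succ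
  rw [stepFun, Finset.sum_eq_single_of_mem j (Finset.mem_range.2 hj), indicator_of_mem hx]
  exact fun i _ hij => indicator_of_notMem (fun hi => (hdisj hij).le_bot ⟨hi, hx⟩) _

lemma measurable_stepFun (n : ℕ) (β : ℝ) (v : ℕ → ℝ) : Measurable (stepFun n β v) :=
  Finset.measurable_sum _ fun j _ => measurable_const.indicator (measurableSet_cell β j)

lemma integrableOn_stepFun (n : ℕ) (β : ℝ) (v : ℕ → ℝ) :
    IntegrableOn (stepFun n β v) (Ico 0 1) :=
  integrable_finsetSum _ fun j _ =>
    (integrable_const (v j)).indicator (measurableSet_cell β j)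

lemma stepFun_sub_smul (n : ℕ) (β c : ℝ) (v w : ℕ → ℝ) :
    stepFun n β (v - c • w) = stepFun n β v - c • stepFun n β w := by
  funext x
  simp only [stepFun, Pi.sub_apply, Pi.smul_apply, smul_eq_mul, Finset.mul_sum,
    ← Finset.sum_sub_distrib]
  refine Finset.sum_congr rfl fun j _ => ?_
  by_cases hx : x ∈ cell β j <;> simp [hx]

lemma add_one_div_mem_cell (hβ : 0 < β) (hx : x ∈ cell β j) :
    (x + 1) / β ∈ cell β (j + 1) := by
  constructor
  · rw [le_div_iff₀ hβ, mul_comm, mul_cutPoint_succ hβ.ne']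
    exact add_le_add_left hx.1 1
  · rw [div_lt_iff₀ hβ, mul_comm, mul_cutPoint_succ hβ.ne']
    exact add_lt_add_left hx.2 1

lemma div_mem_cell_zero (hβ : 0 < β) (hx : x ∈ Ico (0 : ℝ) 1) : x / β ∈ cell β 0 := by
  refine ⟨(cutPoint_zero β).trans_le (div_nonneg hx.1 hβ.le), ?_⟩
  rw [div_lt_iff₀ hβ, mul_comm, mul_cutPoint_succ hβ.ne', cutPoint_zero, zero_add]
  exact hx.2

lemma parryWeight_eq_mul (hβ : β ≠ 0) (j : ℕ) :
    parryWeight β j = β ^ (j + 1) * (1 - cutPoint β j) := by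
  rw [parryWeight, mul_sub, mul_one, cutPoint, pow_succ', mul_assoc,
    pow_mul_sum_inv_pow_succ hβ j, Finset.mul_sum]
  simp only [pow_succ']

lemma parryWeight_succ (hβ : β ≠ 0) (j : ℕ) :
    parryWeight β (j + 1) = β * (parryWeight β j - 1) := by
  rw [parryWeight_eq_mul hβ, parryWeight_eq_mul hβ, cutPoint_succ, inv_pow]
  field_simp
  ring

lemma parrySum_eq_stepFun (n : ℕ) (β : ℝ) : parrySum n β = stepFun n β (parryWeight β) := by
  have hIco (j : ℕ) (F : ℕ → ℝ) :
      ∑ i ∈ Finset.Ico 1 (j + 1), F i = ∑ i ∈ Finset.range j, F (i + 1) := by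
    simp only [Finset.sum_Ico_eq_sum_range, Nat.add_sub_cancel, add_comm 1]
  have hIcc (j : ℕ) (F : ℕ → ℝ) :
      ∑ i ∈ Finset.Icc 1 j, F i = ∑ i ∈ Finset.range j, F (i + 1) := hIco j F
  funext x
  simp only [parrySum, stepFun, hIcc, hIco, cell, cutPoint, parryWeight, inv_pow]

lemma parryDensity_eq_stepFun (n : ℕ) (β : ℝ) :
    parryDensity n β = stepFun n β fun j => parryWeight β j / parryConst n β := by
  funext x
  simp only [parryDensity, parrySum_eq_stepFun, stepFun, Finset.sum_div]
  refine Finset.sum_congr rfl fun j _ => ?_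
  by_cases hx : x ∈ cell β j <;> simp [hx]

end Cells

namespace IsMultinacci

variable {n j : ℕ} {β x : ℝ}

lemma cutPoint_eq_one (hM : IsMultinacci n β) : cutPoint β n = 1 :=
  sum_inv_pow_succ_eq_one hM.pow_eq

lemma cutPoint_le_one (hM : IsMultinacci n β) (hj : j ≤ n) : cutPoint β j ≤ 1 :=
  ((strictMono_cutPoint hM.pos).monotone hj).trans_eq hM.cutPoint_eq_one

lemma one_lt (hM : IsMultinacci n β) : 1 < β := by
  have h : cutPoint β 1 < cutPoint β n := strictMono_cutPoint hM.pos hM.two_le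
  rw [hM.cutPoint_eq_one] at h
  exact (inv_lt_one₀ hM.pos).1 (by simpa [cutPoint] using h)

lemma le_two (hM : IsMultinacci n β) : β ≤ 2 := by
  obtain ⟨k, rfl⟩ : ∃ k, n = k + 1 := ⟨n - 1, by have := hM.two_le; omega⟩
  have h := mul_cutPoint_succ hM.pos.ne' k
  rw [hM.cutPoint_eq_one, mul_one] at h
  linarith [hM.cutPoint_le_one k.le_succ]

lemma cell_subset_Ico (hM : IsMultinacci n β) (hj : j < n) : cell β j ⊆ Ico 0 1 :=
  Ico_subset_Ico (cutPoint_nonneg hM.pos j) (hM.cutPoint_le_one hj)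

lemma exists_mem_cell (hM : IsMultinacci n β) (hx : x ∈ Ico (0 : ℝ) 1) :
    ∃ j < n, x ∈ cell β j :=
  exists_mem_cell_of_lt_cutPoint hx.1 (hx.2.trans_eq hM.cutPoint_eq_one.symm)

lemma sum_setIntegral_cell (hM : IsMultinacci n β) {f : ℝ → ℝ} (hf : IntegrableOn f (Ico 0 1)) :
    ∑ j ∈ Finset.range n, ∫ x in cell β j, f x = ∫ x in Ico (0 : ℝ) 1, f x := by
  have hle (j : ℕ) : cutPoint β j ≤ cutPoint β (j + 1) :=
    (strictMono_cutPoint hM.pos j.lt_succ_self).le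
  have hcell (j : ℕ) : ∫ x in cell β j, f x = ∫ x in cutPoint β j..cutPoint β (j + 1), f x := by
    rw [cell, intervalIntegral.integral_of_le (hle j), integral_Ico_eq_integral_Ioc]
  simp only [hcell]
  rw [intervalIntegral.sum_integral_adjacent_intervals fun j hj =>
      (intervalIntegrable_iff_integrableOn_Ico_of_le (hle j)).2
        (hf.mono_set (hM.cell_subset_Ico hj)),
    cutPoint_zero, hM.cutPoint_eq_one, intervalIntegral.integral_of_le zero_le_one,
    integral_Ico_eq_integral_Ioc]

lemma integral_stepFun (hM : IsMultinacci n β) (v : ℕ → ℝ) :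
    ∫ x in Ico (0 : ℝ) 1, stepFun n β v x = ∑ j ∈ Finset.range n, β⁻¹ ^ (j + 1) * v j := by
  rw [← hM.sum_setIntegral_cell (integrableOn_stepFun n β v)]
  refine Finset.sum_congr rfl fun j hj => ?_
  rw [setIntegral_congr_fun (measurableSet_cell β j) fun x hx =>
      stepFun_of_mem_cell hM.pos (Finset.mem_range.1 hj) hx v,
    setIntegral_const, volume_real_cell hM.pos, smul_eq_mul]

lemma abs_integral_stepFun_le (hM : IsMultinacci n β) {v : ℕ → ℝ} {B : ℝ}
    (hB : ∀ j < n, |v j| ≤ B) : |∫ x in Ico (0 : ℝ) 1, stepFun n β v x| ≤ B := by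
  have hbound : ∀ x ∈ Ico (0 : ℝ) 1, ‖stepFun n β v x‖ ≤ B := fun x hx => by
    obtain ⟨j, hj, hxj⟩ := hM.exists_mem_cell hx
    rw [stepFun_of_mem_cell hM.pos hj hxj]
    exact hB j hj
  simpa using norm_setIntegral_le_of_norm_le_const
    (measure_Ico_lt_top (μ := volume) (a := (0 : ℝ)) (b := 1)) hbound

lemma transfer_of_mem_cell (hM : IsMultinacci n β) (hj : j < n) (hx : x ∈ cell β j)
    (f : ℝ → ℝ) :
    transfer β f x = β⁻¹ * (f (x / β) + if j + 1 < n then f ((x + 1) / β) else 0) := by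
  have h₀ : x / β < 1 := (hM.cell_subset_Ico (by linarith [hM.two_le])
    (div_mem_cell_zero hM.pos (hM.cell_subset_Ico hj hx))).2
  have hmem := add_one_div_mem_cell hM.pos hx
  have h₁ : (x + 1) / β < 1 ↔ j + 1 < n := by
    refine ⟨fun h => lt_of_not_ge fun hn => h.not_ge ?_, fun h => (hM.cell_subset_Ico h hmem).2⟩
    have hcut : cutPoint β (j + 1) = 1 := by rw [le_antisymm hj hn, hM.cutPoint_eq_one]
    exact hcut.symm.trans_le hmem.1
  simp [transfer, Finset.sum_range_succ, h₀, h₁]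

lemma transfer_stepFun (hM : IsMultinacci n β) (v : ℕ → ℝ) :
    EqOn (transfer β (stepFun n β v)) (β⁻¹ • stepFun n β (cellTransfer n v)) (Ico 0 1) := by
  intro x hx
  obtain ⟨j, hj, hxj⟩ := hM.exists_mem_cell hx
  rw [hM.transfer_of_mem_cell hj hxj, Pi.smul_apply, stepFun_of_mem_cell hM.pos hj hxj,
    stepFun_of_mem_cell hM.pos (by omega) (div_mem_cell_zero hM.pos hx), cellTransfer,
    smul_eq_mul]
  split_ifs with h
  · rw [stepFun_of_mem_cell hM.pos h (add_one_div_mem_cell hM.pos hxj)]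
  · rfl

lemma iterate_transfer_stepFun (hM : IsMultinacci n β) (v : ℕ → ℝ) (m : ℕ) :
    EqOn ((transfer β)^[m] (stepFun n β v)) (β⁻¹ ^ m • stepFun n β ((cellTransfer n)^[m] v))
      (Ico 0 1) := by
  induction m with
  | zero => intro x _; simp
  | succ m ih =>
    intro x hx
    rw [Function.iterate_succ_apply', transfer_congr hM.pos ih hx, transfer_smul, Pi.smul_apply,
      hM.transfer_stepFun _ hx, pow_succ, mul_smul, Function.iterate_succ_apply']
    rfl

lemma cellTransfer_parryWeight (hM : IsMultinacci n β) (hj : j < n) :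
    cellTransfer n (parryWeight β) j = β * parryWeight β j := by
  have h₀ : parryWeight β 0 = β := by simp [parryWeight]
  have hsucc : (if j + 1 < n then parryWeight β (j + 1) else 0) = parryWeight β (j + 1) := by
    refine ite_eq_left_iff.2 fun h => ?_
    rw [parryWeight_eq_mul hM.pos.ne', le_antisymm hj (not_lt.1 h), hM.cutPoint_eq_one, sub_self,
      mul_zero]
  rw [cellTransfer, h₀, hsucc, parryWeight_succ hM.pos.ne']
  ring

lemma one_le_parryWeight (hM : IsMultinacci n β) (hj : j < n) : 1 ≤ parryWeight β j := by
  have h : 0 ≤ parryWeight β (j + 1) := by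
    rw [parryWeight_eq_mul hM.pos.ne']
    exact mul_nonneg (pow_pos hM.pos _).le (sub_nonneg.2 (hM.cutPoint_le_one hj))
  rw [parryWeight_succ hM.pos.ne'] at h
  exact sub_nonneg.1 (nonneg_of_mul_nonneg_right h hM.pos)

lemma parryWeight_le (hM : IsMultinacci n β) (hj : j < n) : parryWeight β j ≤ β ^ n :=
  (sub_le_self _ (Finset.sum_nonneg fun i _ => (pow_pos hM.pos (i + 1)).le)).trans
    (pow_le_pow_right₀ hM.one_lt.le hj)

lemma parrySum_mem_Icc (hM : IsMultinacci n β) (hx : x ∈ Ico (0 : ℝ) 1) :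
    parrySum n β x ∈ Icc 1 (β ^ n) := by
  obtain ⟨j, hj, hxj⟩ := hM.exists_mem_cell hx
  rw [parrySum_eq_stepFun, stepFun_of_mem_cell hM.pos hj hxj]
  exact ⟨hM.one_le_parryWeight hj, hM.parryWeight_le hj⟩

lemma transfer_parrySum (hM : IsMultinacci n β) :
    EqOn (transfer β (parrySum n β)) (parrySum n β) (Ico 0 1) := by
  intro x hx
  obtain ⟨j, hj, hxj⟩ := hM.exists_mem_cell hx
  rw [parrySum_eq_stepFun, hM.transfer_stepFun _ hx, Pi.smul_apply,
    stepFun_of_mem_cell hM.pos hj hxj, stepFun_of_mem_cell hM.pos hj hxj,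
    hM.cellTransfer_parryWeight hj, smul_eq_mul, inv_mul_cancel_left₀ hM.pos.ne']

lemma one_le_parryConst (hM : IsMultinacci n β) : 1 ≤ parryConst n β := by
  have hint : IntegrableOn (parrySum n β) (Ico 0 1) := by
    rw [parrySum_eq_stepFun]
    exact integrableOn_stepFun n β _
  simpa [parryConst] using setIntegral_mono_on (integrable_const (1 : ℝ)) hint measurableSet_Ico
    fun x hx => (hM.parrySum_mem_Icc hx).1

lemma parryConst_pos (hM : IsMultinacci n β) : 0 < parryConst n β :=
  one_pos.trans_le hM.one_le_parryConst

lemma abs_parryWeight_div_parryConst_le (hM : IsMultinacci n β) (hj : j < n) :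
    |parryWeight β j / parryConst n β| ≤ β ^ n := by
  have hw : 0 ≤ parryWeight β j := zero_le_one.trans (hM.one_le_parryWeight hj)
  rw [abs_of_nonneg (div_nonneg hw hM.parryConst_pos.le)]
  exact (div_le_self hw hM.one_le_parryConst).trans (hM.parryWeight_le hj)

lemma isPDF_parryDensity (hM : IsMultinacci n β) : IsPDF (parryDensity n β) := by
  refine .of_integral_eq_one ?_ (fun x hx => ?_) ?_
  · rw [parryDensity_eq_stepFun]
    exact measurable_stepFun n β _
  · exact div_nonneg (zero_le_one.trans (hM.parrySum_mem_Icc hx).1) hM.parryConst_pos.le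
  · simp only [parryDensity, integral_div]
    exact div_self hM.parryConst_pos.ne'

lemma transfer_parryDensity (hM : IsMultinacci n β) :
    EqOn (transfer β (parryDensity n β)) (parryDensity n β) (Ico 0 1) := by
  have h : parryDensity n β = (parryConst n β)⁻¹ • parrySum n β :=
    funext fun x => div_eq_inv_mul _ _
  intro x hx
  rw [h, transfer_smul, Pi.smul_apply, Pi.smul_apply, hM.transfer_parrySum hx]

lemma measurePreserving_parryDensity (hM : IsMultinacci n β) :
    MeasurePreserving (betaMap β) (densityLaw (parryDensity n β))
      (densityLaw (parryDensity n β)) := by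
  have h := measurePreserving_betaMap hM.pos hM.le_two hM.isPDF_parryDensity
  rwa [densityLaw_congr hM.transfer_parryDensity] at h

end IsMultinacci

section Roots

namespace IsMultinacci

variable {n : ℕ} {β : ℝ} {z : ℂ}

lemma le_of_pow_le_geom_sum (hM : IsMultinacci n β) {x : ℝ} (hx : 0 < x)
    (h : x ^ n ≤ ∑ i ∈ Finset.range n, x ^ i) : x ≤ β := by
  by_contra! hlt
  have hsum : ∑ i ∈ Finset.range n, x⁻¹ ^ (i + 1) < 1 := by
    rw [← sum_inv_pow_succ_eq_one hM.pow_eq]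
    refine Finset.sum_lt_sum_of_nonempty
      (Finset.nonempty_range_iff.2 (by linarith [hM.two_le])) fun i _ => ?_
    exact pow_lt_pow_left₀ (inv_strictAnti₀ hM.pos hlt) (inv_pos.2 hx).le i.succ_ne_zero
  rw [← pow_mul_sum_inv_pow_succ hx.ne'] at h
  exact h.not_gt (mul_lt_of_lt_one_right (pow_pos hx n) hsum)

lemma norm_le_of_root (hM : IsMultinacci n β) (h : z ^ n = ∑ i ∈ Finset.range n, z ^ i) :
    ‖z‖ ≤ β := by
  refine hM.le_of_pow_le_geom_sum (norm_pos_iff.2 (ne_zero_of_pow_eq_geom_sum h)) ?_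
  rw [← norm_pow, h]
  exact (norm_sum_le _ _).trans_eq (by simp only [norm_pow])

-- Equality must hold in the triangle inequality for `1 + z + ⋯ + z ^ (n - 1)`, hence for `1 + z`.
lemma eq_of_root_of_norm_eq (hM : IsMultinacci n β) (h : z ^ n = ∑ i ∈ Finset.range n, z ^ i)
    (hz : ‖z‖ = β) : z = β := by
  obtain ⟨k, rfl⟩ := Nat.exists_eq_add_of_le hM.two_le
  have htail : ‖∑ i ∈ Finset.range k, z ^ (2 + i)‖ ≤ ∑ i ∈ Finset.range k, β ^ (2 + i) :=
    (norm_sum_le _ _).trans_eq (by simp only [norm_pow, hz])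
  have hnorm : ‖1 + z + ∑ i ∈ Finset.range k, z ^ (2 + i)‖ =
      1 + β + ∑ i ∈ Finset.range k, β ^ (2 + i) := by
    have hsplit {K : Type} [Field K] (w : K) : ∑ i ∈ Finset.range (2 + k), w ^ i =
        1 + w + ∑ i ∈ Finset.range k, w ^ (2 + i) := by
      simp [Finset.sum_range_add, Finset.sum_range_succ]
    rw [← hsplit, ← hsplit, ← h, norm_pow, hz, hM.pow_eq]
  have hadd : ‖1 + z‖ = ‖(1 : ℂ)‖ + ‖z‖ := by
    refine le_antisymm (norm_add_le _ _) ?_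
    rw [norm_one, hz]
    linarith [norm_add_le (1 + z) (∑ i ∈ Finset.range k, z ^ (2 + i))]
  simpa [hz] using (sameRay_iff_norm_add.2 hadd).norm_smul_eq

end IsMultinacci

open Polynomial

variable {n : ℕ} {β : ℝ} {z l : ℂ}

lemma isRoot_charPoly : (charPoly n).IsRoot z ↔ z ^ n = ∑ i ∈ Finset.range n, z ^ i := by
  rw [IsRoot.def, charPoly, eval_sub, eval_finsetSum, sub_eq_zero]
  simp only [eval_pow, eval_X]

lemma monic_charPoly (n : ℕ) : (charPoly n).Monic := by
  refine monic_X_pow_sub ((degree_sum_le _ _).trans_lt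
    ((Finset.sup_lt_iff (WithBot.bot_lt_coe n)).2 fun i hi => ?_))
  rw [degree_X_pow]
  exact Nat.cast_lt.2 (Finset.mem_range.1 hi)

lemma X_sub_one_mul_charPoly (n : ℕ) :
    (X - 1) * charPoly n = X ^ (n + 1) - 2 * X ^ n + 1 := by
  rw [charPoly, mul_sub, mul_geom_sum]
  ring

lemma pow_mul_two_sub_of_isRoot_charPoly (h : (charPoly n).IsRoot z) : z ^ n * (2 - z) = 1 := by
  have heval := congrArg (eval z) (X_sub_one_mul_charPoly n)
  simp only [eval_add, eval_mul, eval_sub, eval_X, eval_one, eval_pow, eval_ofNat,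
    h.eq_zero] at heval
  linear_combination heval

lemma succ_mul_of_isRoot_derivative_charPoly (h : (charPoly n).IsRoot z)
    (h' : (derivative (charPoly n)).IsRoot z) : (n + 1) * z = 2 * n := by
  have heval := congrArg (fun q => eval z (derivative q)) (X_sub_one_mul_charPoly n)
  simp only [derivative_mul, derivative_add, derivative_sub, derivative_X, derivative_one,
    derivative_X_pow, eval_add, eval_mul, eval_sub, eval_X, eval_one, eval_pow, eval_C,
    h.eq_zero, h'.eq_zero, derivative_ofNat, eval_zero, eval_ofNat] at heval
  have hz := ne_zero_of_pow_eq_geom_sum (isRoot_charPoly.1 h)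
  cases n with
  | zero => simp at heval
  | succ k =>
    refine mul_left_cancel₀ (pow_ne_zero k hz) ?_
    simp only [Nat.add_sub_cancel, pow_succ] at heval
    push_cast at heval ⊢
    linear_combination -heval

-- A double root would be `x = 2n / (n + 1)` with `2 x ^ n = n + 1`, against Bernoulli's inequality.
lemma nodup_roots_charPoly (hn : 2 ≤ n) : (charPoly n).roots.Nodup := by
  rw [Multiset.nodup_iff_count_le_one]
  intro z
  rw [count_roots]
  by_contra! hmult
  obtain ⟨h, h'⟩ := (one_lt_rootMultiplicity_iff_isRoot (monic_charPoly n).ne_zero).1 hmult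
  have hz := succ_mul_of_isRoot_derivative_charPoly h h'
  have hpow : 2 * z ^ n = n + 1 := by
    linear_combination (n + 1 : ℂ) * pow_mul_two_sub_of_isRoot_charPoly h + z ^ n * hz
  have hn' : (2 : ℝ) ≤ n := by exact_mod_cast hn
  have hnorm : ‖z‖ = 1 + (n - 1) / (n + 1) := by
    have := congrArg norm hz
    rw [norm_mul, norm_mul, ← Nat.cast_succ, Complex.norm_natCast, Complex.norm_natCast,
      Complex.norm_ofNat] at this
    push_cast at this
    field_simp
    linarith
  have hnorm_pow : 2 * ‖z‖ ^ n = n + 1 := by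
    have := congrArg norm hpow
    rwa [norm_mul, norm_pow, ← Nat.cast_succ, Complex.norm_natCast, Complex.norm_ofNat,
      Nat.cast_succ] at this
  have hbernoulli := one_add_mul_le_pow
    (show (-2 : ℝ) ≤ (n - 1) / (n + 1) from
      (by norm_num : (-2 : ℝ) ≤ 0).trans (div_nonneg (by linarith) (by linarith))) n
  rw [← hnorm] at hbernoulli
  have hgap : (1 + n * ((n - 1) / (n + 1)) : ℝ) - (n + 1) / 2 = (n - 1) ^ 2 / (2 * (n + 1)) := by
    field_simp
    ring
  have : (0 : ℝ) < (n - 1) ^ 2 / (2 * (n + 1)) :=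
    div_pos (pow_pos (by linarith) 2) (by linarith)
  linarith

lemma injective_of_roots_charPoly_eq (hn : 2 ≤ n) {r : Fin n → ℂ}
    (hr : (charPoly n).roots = Finset.univ.val.map r) : Function.Injective r := fun i j hij =>
  Multiset.inj_on_of_nodup_map (hr ▸ nodup_roots_charPoly hn) i (Finset.mem_univ i) j
    (Finset.mem_univ j) hij

lemma pow_eq_geom_sum_iff_of_roots_charPoly_eq {r : Fin n → ℂ}
    (hr : (charPoly n).roots = Finset.univ.val.map r) :
    z ^ n = ∑ k ∈ Finset.range n, z ^ k ↔ ∃ i, r i = z := by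
  rw [← isRoot_charPoly, ← mem_roots (monic_charPoly n).ne_zero, hr]
  simp

lemma IsMultinacci.eq_of_antitone_norm (hM : IsMultinacci n β) {r : Fin n → ℂ}
    (hr : (charPoly n).roots = Finset.univ.val.map r) (hanti : Antitone fun i => ‖r i‖)
    {i : Fin n} (hi : i.val = 0) : r i = β := by
  have hroot := (pow_eq_geom_sum_iff_of_roots_charPoly_eq hr).2 ⟨i, rfl⟩
  obtain ⟨j, hj⟩ := (pow_eq_geom_sum_iff_of_roots_charPoly_eq (z := β) hr).1
    (by exact_mod_cast hM.pow_eq)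
  refine hM.eq_of_root_of_norm_eq hroot (le_antisymm (hM.norm_le_of_root hroot) ?_)
  have hle : ‖r j‖ ≤ ‖r i‖ := hanti (Fin.le_def.2 (hi.trans_le (Nat.zero_le j)))
  rwa [hj, Complex.norm_of_nonneg hM.pos.le] at hle

lemma IsSecondRoot.norm_lt (hl : IsSecondRoot n l) (hM : IsMultinacci n β) : ‖l‖ < β := by
  obtain ⟨r, hr, hanti, h1, rfl⟩ := hl
  have hroot := (pow_eq_geom_sum_iff_of_roots_charPoly_eq hr).2 ⟨⟨1, h1⟩, rfl⟩
  refine (hM.norm_le_of_root hroot).lt_of_ne fun h => ?_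
  have hzero : r ⟨0, by omega⟩ = β := hM.eq_of_antitone_norm hr hanti rfl
  have heq := injective_of_roots_charPoly_eq hM.two_le hr
    ((hM.eq_of_root_of_norm_eq hroot h).trans hzero.symm)
  simp at heq

lemma IsSecondRoot.exists_injective_roots (hl : IsSecondRoot n l) (hM : IsMultinacci n β) :
    ∃ r : Fin n → ℂ, Function.Injective r ∧
      (∀ i, r i ^ n = ∑ k ∈ Finset.range n, r i ^ k) ∧ ∀ i, r i = β ∨ ‖r i‖ ≤ ‖l‖ := by
  obtain ⟨r, hr, hanti, h1, rfl⟩ := hl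
  refine ⟨r, injective_of_roots_charPoly_eq hM.two_le hr,
    fun i => (pow_eq_geom_sum_iff_of_roots_charPoly_eq hr).2 ⟨i, rfl⟩, fun i => ?_⟩
  rcases i.val.eq_zero_or_pos with hi | hi
  · exact .inl (hM.eq_of_antitone_norm hr hanti hi)
  · exact .inr (hanti (Fin.le_def.2 hi))

end Roots

section Decay

open Matrix
open scoped Matrix.Norms.Operator

lemma exists_norm_le_of_mulVec_succ {ι 𝕜 : Type*} [Fintype ι] [DecidableEq ι] [NormedField 𝕜]
    {V : Matrix ι ι 𝕜} (hV : IsUnit V.det) (r : ι → 𝕜) :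
    ∃ C : ℝ, 0 ≤ C ∧ ∀ (u : ℕ → ι → 𝕜) (ρ : ℝ), 0 ≤ ρ →
      (∀ m i, (V *ᵥ u (m + 1)) i = r i * (V *ᵥ u m) i) →
      (∀ i, (V *ᵥ u 0) i = 0 ∨ ‖r i‖ ≤ ρ) → ∀ m, ‖u m‖ ≤ C * ‖u 0‖ * ρ ^ m := by
  refine ⟨‖V⁻¹‖ * ‖V‖, by positivity, fun u ρ hρ hsucc hr m => ?_⟩
  have hpow (i : ι) : (V *ᵥ u m) i = r i ^ m * (V *ᵥ u 0) i := by
    induction m with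
    | zero => simp
    | succ m ih => rw [hsucc, ih, pow_succ', mul_assoc]
  have hVu : ‖V *ᵥ u m‖ ≤ ρ ^ m * ‖V *ᵥ u 0‖ := by
    refine (pi_norm_le_iff_of_nonneg (by positivity)).2 fun i => ?_
    rw [hpow i]
    rcases hr i with h | h
    · rw [h, mul_zero, norm_zero]
      positivity
    · rw [norm_mul, norm_pow]
      gcongr
      exact norm_le_pi_norm _ i
  calc ‖u m‖ = ‖V⁻¹ *ᵥ (V *ᵥ u m)‖ := by rw [mulVec_mulVec, nonsing_inv_mul V hV, one_mulVec]
    _ ≤ ‖V⁻¹‖ * ‖V *ᵥ u m‖ := linfty_opNorm_mulVec _ _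
    _ ≤ ‖V⁻¹‖ * (ρ ^ m * (‖V‖ * ‖u 0‖)) := by
        gcongr
        exact hVu.trans (by gcongr; exact linfty_opNorm_mulVec _ _)
    _ = ‖V⁻¹‖ * ‖V‖ * ‖u 0‖ * ρ ^ m := by ring

/-- The matrix whose rows `(z⁻¹, …, z⁻ⁿ)`, for `z = r i`, are the eigenfunctionals of
`cellTransfer n` when the `r i` are roots of `charPoly n`. -/
def eigenMatrix {K : Type*} [Field K] {n : ℕ} (r : Fin n → K) : Matrix (Fin n) (Fin n) K :=
  of fun i j => (r i)⁻¹ ^ (j.val + 1)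

lemma isUnit_det_eigenMatrix {K : Type*} [Field K] {n : ℕ} {r : Fin n → K}
    (hr : Function.Injective r) (hr₀ : ∀ i, r i ≠ 0) : IsUnit (eigenMatrix r).det := by
  have heq : eigenMatrix r = diagonal (fun i => (r i)⁻¹) * vandermonde fun i => (r i)⁻¹ := by
    ext i j
    rw [diagonal_mul, vandermonde_apply, eigenMatrix, of_apply, pow_succ']
  rw [isUnit_iff_ne_zero, heq, det_mul, det_diagonal]
  exact mul_ne_zero (Finset.prod_ne_zero_iff.2 fun i _ => inv_ne_zero (hr₀ i))
    (det_vandermonde_ne_zero_iff.2 fun i j hij => hr (inv_injective hij))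

lemma eigenMatrix_mulVec {K : Type*} [Field K] {n : ℕ} (r : Fin n → K) (u : ℕ → K) (i : Fin n) :
    (eigenMatrix r *ᵥ fun j => u j) i = ∑ j ∈ Finset.range n, (r i)⁻¹ ^ (j + 1) * u j := by
  rw [Finset.sum_range]
  rfl

lemma sum_inv_pow_mul_cellTransfer {n : ℕ} {z : ℂ} (h : z ^ n = ∑ i ∈ Finset.range n, z ^ i)
    (v : ℕ → ℝ) :
    ∑ j ∈ Finset.range n, z⁻¹ ^ (j + 1) * (cellTransfer n v j : ℂ) =
      z * ∑ j ∈ Finset.range n, z⁻¹ ^ (j + 1) * (v j : ℂ) := by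
  have hz := ne_zero_of_pow_eq_geom_sum h
  have hone := sum_inv_pow_succ_eq_one h
  cases n with
  | zero => simp
  | succ k =>
    have hshift : ∑ j ∈ Finset.range (k + 1), z⁻¹ ^ (j + 1) *
        ((if j + 1 < k + 1 then v (j + 1) else 0 : ℝ) : ℂ) =
        ∑ j ∈ Finset.range k, z⁻¹ ^ (j + 1) * (v (j + 1) : ℂ) := by
      rw [Finset.sum_range_succ, if_neg (lt_irrefl _), Complex.ofReal_zero, mul_zero, add_zero]
      exact Finset.sum_congr rfl fun j hj => by
        rw [if_pos (Nat.succ_lt_succ (Finset.mem_range.1 hj))]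
    simp only [cellTransfer, Complex.ofReal_add, mul_add, Finset.sum_add_distrib, hshift]
    rw [← Finset.sum_mul, hone, one_mul,
      Finset.sum_range_succ' fun j => z⁻¹ ^ (j + 1) * (v j : ℂ), mul_add, Finset.mul_sum, add_comm]
    simp [pow_succ' z⁻¹, ← mul_assoc, hz]

lemma IsMultinacci.exists_abs_iterate_cellTransfer_le {n : ℕ} {β : ℝ} (hM : IsMultinacci n β)
    {l : ℂ} (hl : IsSecondRoot n l) :
    ∃ C : ℝ, 0 ≤ C ∧ ∀ (v : ℕ → ℝ) (B : ℝ), (∀ j < n, |v j| ≤ B) →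
      ∑ j ∈ Finset.range n, β⁻¹ ^ (j + 1) * v j = 0 →
      ∀ m, ∀ j < n, |(cellTransfer n)^[m] v j| ≤ C * B * ‖l‖ ^ m := by
  obtain ⟨r, hinj, hroot, hr⟩ := hl.exists_injective_roots hM
  obtain ⟨C, hC, hdecay⟩ := exists_norm_le_of_mulVec_succ
    (isUnit_det_eigenMatrix hinj fun i => ne_zero_of_pow_eq_geom_sum (hroot i)) r
  refine ⟨C, hC, fun v B hB hsum m j hj => ?_⟩
  let u (m : ℕ) (j : Fin n) : ℂ := ((cellTransfer n)^[m] v j : ℝ)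
  have hVu (m : ℕ) (i : Fin n) : (eigenMatrix r *ᵥ u m) i =
      ∑ j ∈ Finset.range n, (r i)⁻¹ ^ (j + 1) * (((cellTransfer n)^[m] v j : ℝ) : ℂ) :=
    eigenMatrix_mulVec r (fun j => (((cellTransfer n)^[m] v j : ℝ) : ℂ)) i
  have hsucc (m : ℕ) (i : Fin n) :
      (eigenMatrix r *ᵥ u (m + 1)) i = r i * (eigenMatrix r *ᵥ u m) i := by
    rw [hVu, hVu, Function.iterate_succ_apply', sum_inv_pow_mul_cellTransfer (hroot i)]
  have hzero (i : Fin n) : (eigenMatrix r *ᵥ u 0) i = 0 ∨ ‖r i‖ ≤ ‖l‖ := by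
    refine (hr i).imp_left fun hi => ?_
    rw [hVu, hi]
    exact_mod_cast hsum
  have hu₀ : ‖u 0‖ ≤ B := (pi_norm_le_iff_of_nonneg ((abs_nonneg _).trans (hB j hj))).2 fun i => by
    simpa [u] using hB i i.2
  calc |(cellTransfer n)^[m] v j| = ‖u m ⟨j, hj⟩‖ := by simp [u]
    _ ≤ ‖u m‖ := norm_le_pi_norm _ _
    _ ≤ C * ‖u 0‖ * ‖l‖ ^ m := hdecay u ‖l‖ (norm_nonneg l) hsucc hzero m
    _ ≤ C * B * ‖l‖ ^ m := by gcongr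

end Decay

section Error

variable {n : ℕ} {β : ℝ} {f g : ℝ → ℝ}

/-- The error made in approximating `f_m = T^m f` by the multiple of the invariant density with
the same integral. -/
def transferError (n : ℕ) (β : ℝ) (m : ℕ) (f : ℝ → ℝ) : ℝ → ℝ :=
  (transfer β)^[m] f - (∫ y in Ico (0 : ℝ) 1, f y) • parryDensity n β

lemma transferError_sub (n : ℕ) (β : ℝ) (m : ℕ) (hf : IntegrableOn f (Ico 0 1))
    (hg : IntegrableOn g (Ico 0 1)) :
    transferError n β m (f - g) = transferError n β m f - transferError n β m g := by
  simp only [transferError, iterate_transfer_sub, integral_sub' hf hg, sub_smul]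
  abel

namespace IsMultinacci

lemma integrableOn_transferError (hM : IsMultinacci n β) (hf : IntegrableOn f (Ico 0 1)) (m : ℕ) :
    IntegrableOn (transferError n β m f) (Ico 0 1) :=
  Integrable.sub (integrableOn_iterate_transfer hM.pos hf m)
    (hM.isPDF_parryDensity.integrableOn.smul _)

lemma transferError_add (hM : IsMultinacci n β) (hf : IntegrableOn f (Ico 0 1)) (m₁ m₂ : ℕ) :
    transferError n β (m₁ + m₂) f = transferError n β m₂ ((transfer β)^[m₁] f) := by
  rw [transferError, transferError, integral_iterate_transfer hM.pos hM.le_two hf, add_comm,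
    Function.iterate_add_apply]

lemma transferError_eqOn_iterate_transfer (hM : IsMultinacci n β) (m : ℕ) (f : ℝ → ℝ) :
    EqOn (transferError n β m f)
      ((transfer β)^[m] (f - (∫ y in Ico (0 : ℝ) 1, f y) • parryDensity n β)) (Ico 0 1) := by
  intro x hx
  rw [transferError, iterate_transfer_sub, iterate_transfer_smul]
  simp only [Pi.sub_apply, Pi.smul_apply,
    iterate_transfer_of_fixed hM.pos hM.transfer_parryDensity m hx]

lemma integral_abs_transferError_le (hM : IsMultinacci n β) (hf : IntegrableOn f (Ico 0 1))
    (m : ℕ) :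
    ∫ x in Ico (0 : ℝ) 1, |transferError n β m f x| ≤ 2 * ∫ x in Ico (0 : ℝ) 1, |f x| := by
  set I := ∫ y in Ico (0 : ℝ) 1, f y
  have hT := integrableOn_iterate_transfer hM.pos hf m
  have hP : IntegrableOn (I • parryDensity n β) (Ico 0 1) :=
    hM.isPDF_parryDensity.integrableOn.smul I
  calc ∫ x in Ico (0 : ℝ) 1, |transferError n β m f x|
      ≤ ∫ x in Ico (0 : ℝ) 1, (|(transfer β)^[m] f x| + |(I • parryDensity n β) x|) :=
        integral_mono (hM.integrableOn_transferError hf m).abs (Integrable.add hT.abs hP.abs)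
          fun x => abs_sub _ _
    _ = (∫ x in Ico (0 : ℝ) 1, |(transfer β)^[m] f x|) + |I| := by
        rw [integral_add hT.abs hP.abs]
        simp only [Pi.smul_apply, smul_eq_mul, abs_mul, integral_const_mul,
          hM.isPDF_parryDensity.integral_abs_eq_one, mul_one]
    _ ≤ (∫ x in Ico (0 : ℝ) 1, |f x|) + ∫ x in Ico (0 : ℝ) 1, |f x| :=
        add_le_add (integral_abs_iterate_transfer_le hM.pos hM.le_two hf m)
          abs_integral_le_integral_abs
    _ = 2 * ∫ x in Ico (0 : ℝ) 1, |f x| := (two_mul _).symm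

lemma exists_abs_iterate_transfer_stepFun_le (hM : IsMultinacci n β) {l : ℂ}
    (hl : IsSecondRoot n l) :
    ∃ C : ℝ, 0 ≤ C ∧ ∀ (v : ℕ → ℝ) (B : ℝ), (∀ j < n, |v j| ≤ B) →
      ∫ x in Ico (0 : ℝ) 1, stepFun n β v x = 0 → ∀ m, ∀ x ∈ Ico (0 : ℝ) 1,
        |(transfer β)^[m] (stepFun n β v) x| ≤ C * B * (β⁻¹ * ‖l‖) ^ m := by
  obtain ⟨C, hC, hdecay⟩ := hM.exists_abs_iterate_cellTransfer_le hl
  refine ⟨C, hC, fun v B hB hzero m x hx => ?_⟩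
  rw [hM.integral_stepFun] at hzero
  obtain ⟨j, hj, hxj⟩ := hM.exists_mem_cell hx
  have hp : 0 < β⁻¹ ^ m := pow_pos (inv_pos.2 hM.pos) m
  calc |(transfer β)^[m] (stepFun n β v) x| = β⁻¹ ^ m * |(cellTransfer n)^[m] v j| := by
        rw [hM.iterate_transfer_stepFun v m hx, Pi.smul_apply, stepFun_of_mem_cell hM.pos hj hxj,
          smul_eq_mul, abs_mul, abs_of_pos hp]
    _ ≤ β⁻¹ ^ m * (C * B * ‖l‖ ^ m) :=
        mul_le_mul_of_nonneg_left (hdecay v B hB hzero m j hj) hp.le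
    _ = C * B * (β⁻¹ * ‖l‖) ^ m := by ring

lemma exists_abs_transferError_stepFun_le (hM : IsMultinacci n β) {l : ℂ}
    (hl : IsSecondRoot n l) :
    ∃ C : ℝ, 0 ≤ C ∧ ∀ (v : ℕ → ℝ) (B : ℝ), (∀ j < n, |v j| ≤ B) → ∀ m, ∀ x ∈ Ico (0 : ℝ) 1,
      |transferError n β m (stepFun n β v) x| ≤ C * B * (β⁻¹ * ‖l‖) ^ m := by
  obtain ⟨C, hC, hdecay⟩ := hM.exists_abs_iterate_transfer_stepFun_le hl
  have hβ := hM.pos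
  refine ⟨C * (1 + β ^ n), by positivity, fun v B hB m x hx => ?_⟩
  set I := ∫ y in Ico (0 : ℝ) 1, stepFun n β v y with hI
  set u : ℕ → ℝ := fun j => parryWeight β j / parryConst n β
  have hIB : |I| ≤ B := hM.abs_integral_stepFun_le hB
  have hw (j : ℕ) (hj : j < n) : |(v - I • u) j| ≤ (1 + β ^ n) * B :=
    calc |v j - I * u j| ≤ |v j| + |I| * |u j| := (abs_sub _ _).trans_eq (by rw [abs_mul])
      _ ≤ B + B * β ^ n := by
        gcongr
        exacts [hB j hj, (abs_nonneg _).trans hIB, hM.abs_parryWeight_div_parryConst_le hj]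
      _ = (1 + β ^ n) * B := by ring
  have hsub : stepFun n β v - I • parryDensity n β = stepFun n β (v - I • u) := by
    rw [parryDensity_eq_stepFun, stepFun_sub_smul]
  have hzero : ∫ x in Ico (0 : ℝ) 1, stepFun n β (v - I • u) x = 0 := by
    rw [← hsub, integral_sub' (integrableOn_stepFun n β v)
      (hM.isPDF_parryDensity.integrableOn.smul I), ← hI]
    simp only [Pi.smul_apply, smul_eq_mul, integral_const_mul,
      hM.isPDF_parryDensity.integral_eq_one, mul_one, sub_self]
  rw [hM.transferError_eqOn_iterate_transfer m _ hx, hsub, mul_assoc C]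
  exact hdecay _ _ hw hzero m x hx

end IsMultinacci

end Error

section Oscillation

variable {n j : ℕ} {β δ E x : ℝ} {f g : ℝ → ℝ}

/-- At distances at most `δ`, the oscillation of `g` inside each cell is at most `E` times
`parrySum n β`. The unit `parrySum n β` is a fixed point of `transfer β`, so that the bound passes
to `transfer β g` with the same `E`. -/
def CellOscLE (n : ℕ) (β : ℝ) (g : ℝ → ℝ) (δ E : ℝ) : Prop :=
  ∀ j < n, ∀ x ∈ cell β j, ∀ y ∈ cell β j, |x - y| ≤ δ → |g x - g y| ≤ E * parrySum n β x

/-- The mean value of `f` on the `j`-th cell. -/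
def cellAverage (β : ℝ) (f : ℝ → ℝ) (j : ℕ) : ℝ := ⨍ y in cell β j, f y

namespace CellOscLE

lemma of_abs_sub_le (hM : IsMultinacci n β) (hE : 0 ≤ E)
    (h : ∀ x ∈ Ico (0 : ℝ) 1, ∀ y ∈ Ico (0 : ℝ) 1, |x - y| ≤ δ → |g x - g y| ≤ E) :
    CellOscLE n β g δ E := fun _j hj x hx y hy hxy =>
  (h x (hM.cell_subset_Ico hj hx) y (hM.cell_subset_Ico hj hy) hxy).trans
    (le_mul_of_one_le_right hE (hM.parrySum_mem_Icc (hM.cell_subset_Ico hj hx)).1)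

lemma transfer (h : CellOscLE n β g δ E) (hM : IsMultinacci n β) :
    CellOscLE n β (transfer β g) (β * δ) E := by
  intro j hj x hx y hy hxy
  have hβ := hM.pos
  have hx' := hM.cell_subset_Ico hj hx
  have hy' := hM.cell_subset_Ico hj hy
  have hδ (c : ℝ) : |(x + c) / β - (y + c) / β| ≤ δ := by
    rwa [← sub_div, add_sub_add_right_eq_sub, abs_div, abs_of_pos hβ, div_le_iff₀' hβ]
  have h₀ : |g (x / β) - g (y / β)| ≤ E * parrySum n β (x / β) :=
    h 0 (by omega) _ (div_mem_cell_zero hβ hx') _ (div_mem_cell_zero hβ hy')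
      (by simpa only [add_zero] using hδ 0)
  rw [← hM.transfer_parrySum hx', hM.transfer_of_mem_cell hj hx, hM.transfer_of_mem_cell hj hy,
    hM.transfer_of_mem_cell hj hx, ← mul_sub, abs_mul, abs_of_pos (inv_pos.2 hβ),
    mul_left_comm, add_sub_add_comm, mul_add]
  gcongr
  refine (abs_add_le _ _).trans (add_le_add h₀ ?_)
  split_ifs with hj₁
  · exact h (j + 1) hj₁ _ (add_one_div_mem_cell hβ hx) _ (add_one_div_mem_cell hβ hy) (hδ 1)
  · simp

lemma iterate_transfer (h : CellOscLE n β g δ E) (hM : IsMultinacci n β) (m : ℕ) :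
    CellOscLE n β ((PseudoGolden.transfer β)^[m] g) (β ^ m * δ) E := by
  induction m with
  | zero => simpa using h
  | succ m ih =>
    rw [Function.iterate_succ_apply', pow_succ', mul_assoc]
    exact ih.transfer hM

lemma abs_sub_cellAverage_le (h : CellOscLE n β f 1 E) (hM : IsMultinacci n β)
    (hf : IntegrableOn f (Ico 0 1)) (hj : j < n) (hx : x ∈ cell β j) :
    |f x - cellAverage β f j| ≤ E * parrySum n β x := by
  have hvol : volume.real (cell β j) ≠ 0 := by
    rw [volume_real_cell hM.pos]
    exact (pow_pos (inv_pos.2 hM.pos) _).ne'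
  have hmem : cellAverage β f j ∈ Metric.closedBall (f x) (E * parrySum n β x) := by
    refine (convex_closedBall _ _).set_average_mem Metric.isClosed_closedBall
      ((measureReal_ne_zero_iff measure_Ico_lt_top.ne).1 hvol) measure_Ico_lt_top.ne ?_
      (hf.mono_set (hM.cell_subset_Ico hj))
    refine (ae_restrict_iff' (measurableSet_cell β j)).2 (ae_of_all _ fun y hy => ?_)
    rw [Metric.mem_closedBall']
    have hx' := hM.cell_subset_Ico hj hx
    have hy' := hM.cell_subset_Ico hj hy
    exact h j hj x hx y hy (abs_le.2 ⟨by linarith [hx'.1, hy'.2], by linarith [hx'.2, hy'.1]⟩)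
  exact Metric.mem_closedBall'.1 hmem

end CellOscLE

lemma cellAverage_eq (hβ : 0 < β) (f : ℝ → ℝ) (j : ℕ) :
    cellAverage β f j = β ^ (j + 1) * ∫ y in cell β j, f y := by
  rw [cellAverage, setAverage_eq, volume_real_cell hβ, inv_pow, inv_inv, smul_eq_mul]

namespace IsMultinacci

lemma abs_cellAverage_le (hM : IsMultinacci n β) (hf : IntegrableOn f (Ico 0 1)) (hj : j < n) :
    |cellAverage β f j| ≤ β ^ n * ∫ x in Ico (0 : ℝ) 1, |f x| := by
  rw [cellAverage_eq hM.pos, abs_mul, abs_of_pos (pow_pos hM.pos _)]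
  refine mul_le_mul (pow_le_pow_right₀ hM.one_lt.le hj) ?_ (abs_nonneg _) (pow_pos hM.pos n).le
  exact abs_integral_le_integral_abs.trans (setIntegral_mono_set hf.abs
    (ae_of_all _ fun _ => abs_nonneg _) (hM.cell_subset_Ico hj).eventuallyLE)

lemma integral_stepFun_cellAverage (hM : IsMultinacci n β) (hf : IntegrableOn f (Ico 0 1)) :
    ∫ x in Ico (0 : ℝ) 1, stepFun n β (cellAverage β f) x = ∫ x in Ico (0 : ℝ) 1, f x := by
  rw [hM.integral_stepFun, ← hM.sum_setIntegral_cell hf]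
  refine Finset.sum_congr rfl fun j _ => ?_
  rw [cellAverage_eq hM.pos, inv_pow, inv_mul_cancel_left₀ (pow_pos hM.pos _).ne']

lemma abs_transferError_sub_le (hM : IsMultinacci n β) (hf : IntegrableOn f (Ico 0 1))
    (hE : 0 ≤ E) (h : CellOscLE n β f 1 E) (m : ℕ) (hx : x ∈ Ico (0 : ℝ) 1) :
    |transferError n β m f x - transferError n β m (stepFun n β (cellAverage β f)) x| ≤
      E * β ^ n := by
  have hosc : ∀ y ∈ Ico (0 : ℝ) 1,
      |(f - stepFun n β (cellAverage β f)) y| ≤ (E • parrySum n β) y := fun y hy => by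
    obtain ⟨j, hj, hyj⟩ := hM.exists_mem_cell hy
    rw [Pi.sub_apply, stepFun_of_mem_cell hM.pos hj hyj]
    exact h.abs_sub_cellAverage_le hM hf hj hyj
  have hT := abs_iterate_transfer_le hM.pos hosc m x hx
  rw [iterate_transfer_smul, Pi.smul_apply, smul_eq_mul,
    iterate_transfer_of_fixed hM.pos hM.transfer_parrySum m hx] at hT
  rw [← Pi.sub_apply, ← transferError_sub n β m hf (integrableOn_stepFun n β _), transferError,
    integral_sub' hf (integrableOn_stepFun n β _), hM.integral_stepFun_cellAverage hf, sub_self,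
    zero_smul, sub_zero]
  exact hT.trans (mul_le_mul_of_nonneg_left (hM.parrySum_mem_Icc hx).2 hE)

theorem exists_abs_transferError_le (hM : IsMultinacci n β) {l : ℂ} (hl : IsSecondRoot n l) :
    ∃ C : ℝ, 0 ≤ C ∧ ∀ (g : ℝ → ℝ), IntegrableOn g (Ico 0 1) → ∀ (m₁ m₂ : ℕ) (E : ℝ), 0 ≤ E →
      CellOscLE n β g (β ^ m₁)⁻¹ E → ∀ x ∈ Ico (0 : ℝ) 1,
        |transferError n β (m₁ + m₂) g x| ≤
          C * (∫ y in Ico (0 : ℝ) 1, |g y|) * (β⁻¹ * ‖l‖) ^ m₂ + E * β ^ n := by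
  obtain ⟨C, hC, hstep⟩ := hM.exists_abs_transferError_stepFun_le hl
  have hβ := hM.pos
  refine ⟨C * β ^ n, by positivity, fun g hg m₁ m₂ E hE hosc x hx => ?_⟩
  rw [hM.transferError_add hg]
  set F := (transfer β)^[m₁] g
  have hF : IntegrableOn F (Ico 0 1) := integrableOn_iterate_transfer hβ hg m₁
  have hoscF : CellOscLE n β F 1 E := by
    simpa only [mul_inv_cancel₀ (pow_pos hβ m₁).ne'] using hosc.iterate_transfer hM m₁
  have havg := hstep (cellAverage β F) _ (fun j hj => hM.abs_cellAverage_le hF hj) m₂ x hx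
  calc |transferError n β m₂ F x|
      ≤ |transferError n β m₂ (stepFun n β (cellAverage β F)) x| +
        |transferError n β m₂ F x - transferError n β m₂ (stepFun n β (cellAverage β F)) x| := by
        simpa using abs_add_le (transferError n β m₂ (stepFun n β (cellAverage β F)) x)
          (transferError n β m₂ F x - transferError n β m₂ (stepFun n β (cellAverage β F)) x)
    _ ≤ C * (β ^ n * ∫ y in Ico (0 : ℝ) 1, |F y|) * (β⁻¹ * ‖l‖) ^ m₂ + E * β ^ n :=
        add_le_add havg (hM.abs_transferError_sub_le hF hE hoscF m₂ hx)
    _ ≤ C * (β ^ n * ∫ y in Ico (0 : ℝ) 1, |g y|) * (β⁻¹ * ‖l‖) ^ m₂ + E * β ^ n := by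
        have hFg := integral_abs_iterate_transfer_le hβ hM.le_two hg m₁
        gcongr C * (β ^ n * ?_) * _ + _
    _ = C * β ^ n * (∫ y in Ico (0 : ℝ) 1, |g y|) * (β⁻¹ * ‖l‖) ^ m₂ + E * β ^ n := by ring

end IsMultinacci

end Oscillation

section Lipschitz

variable {n : ℕ} {β L : ℝ} {f : ℝ → ℝ}

lemma nonneg_of_abs_sub_le_mul (hL : ∀ x ∈ Ico (0 : ℝ) 1, ∀ y ∈ Ico (0 : ℝ) 1,
    |f x - f y| ≤ L * |x - y|) : 0 ≤ L :=
  nonneg_of_mul_nonneg_left ((abs_nonneg _).trans (hL 0 (by norm_num) (1 / 2) (by norm_num)))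
    (by norm_num)

lemma integrableOn_of_abs_sub_le_mul (hL : ∀ x ∈ Ico (0 : ℝ) 1, ∀ y ∈ Ico (0 : ℝ) 1,
    |f x - f y| ≤ L * |x - y|) : IntegrableOn f (Ico 0 1) := by
  obtain ⟨g, hg, hfg⟩ := (LipschitzOnWith.of_dist_le' hL).extend_real
  exact ((hg.continuous.continuousOn.integrableOn_Icc (a := 0) (b := 1)).mono_set
    Ico_subset_Icc_self).congr_fun hfg.symm measurableSet_Ico

theorem IsMultinacci.exists_abs_transferError_le_of_lipschitz (hM : IsMultinacci n β) {l : ℂ}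
    (hl : IsSecondRoot n l) :
    ∃ C₁ C₂ : ℝ, ∀ (f : ℝ → ℝ) (L : ℝ),
      (∀ x ∈ Ico (0 : ℝ) 1, ∀ y ∈ Ico (0 : ℝ) 1, |f x - f y| ≤ L * |x - y|) →
      ∀ m₁ m₂ : ℕ, ∀ x ∈ Ico (0 : ℝ) 1, |transferError n β (m₁ + m₂) f x| ≤
        C₁ * (∫ y in Ico (0 : ℝ) 1, |f y|) * (β⁻¹ * ‖l‖) ^ m₂ + C₂ * (β ^ m₁)⁻¹ * L := by
  obtain ⟨C, -, hrate⟩ := hM.exists_abs_transferError_le hl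
  refine ⟨C, β ^ n, fun f L hL m₁ m₂ x hx => ?_⟩
  have hL₀ := nonneg_of_abs_sub_le_mul hL
  have hE : 0 ≤ L * (β ^ m₁)⁻¹ := mul_nonneg hL₀ (inv_pos.2 (pow_pos hM.pos _)).le
  have hosc : CellOscLE n β f (β ^ m₁)⁻¹ (L * (β ^ m₁)⁻¹) := .of_abs_sub_le hM hE
    fun x hx y hy hxy => (hL x hx y hy).trans (mul_le_mul_of_nonneg_left hxy hL₀)
  refine (hrate f (integrableOn_of_abs_sub_le_mul hL) m₁ m₂ _ hE hosc x hx).trans_eq ?_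
  ring

end Lipschitz

section Convergence

variable {n : ℕ} {β : ℝ} {l : ℂ} {f g : ℝ → ℝ}

namespace IsMultinacci

lemma tendstoUniformlyOn_transferError (hM : IsMultinacci n β) (hl : IsSecondRoot n l)
    (hg : ContinuousOn g (Icc 0 1)) :
    TendstoUniformlyOn (fun m => transferError n β m g) 0 atTop (Ico 0 1) := by
  obtain ⟨C, -, hrate⟩ := hM.exists_abs_transferError_le hl
  have hβ := hM.pos
  rw [Metric.tendstoUniformlyOn_iff]
  intro ε hε
  set E := ε / 2 / β ^ n
  have hE : 0 < E := by positivity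
  obtain ⟨δ, hδ, hgδ⟩ := Metric.uniformContinuousOn_iff_le.1
    (isCompact_Icc.uniformContinuousOn_of_continuous hg) E hE
  obtain ⟨m₁, hm₁⟩ : ∃ m₁ : ℕ, (β ^ m₁)⁻¹ < δ := by
    simpa only [inv_pow] using exists_pow_lt_of_lt_one hδ (inv_lt_one_of_one_lt₀ hM.one_lt)
  have hosc : CellOscLE n β g (β ^ m₁)⁻¹ E := .of_abs_sub_le hM hE.le fun x hx y hy hxy =>
    hgδ x (Ico_subset_Icc_self hx) y (Ico_subset_Icc_self hy) (hxy.trans hm₁.le)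
  have hρ : β⁻¹ * ‖l‖ < 1 := (inv_mul_lt_one₀ hβ).2 (hl.norm_lt hM)
  have hlim : Tendsto (fun m₂ : ℕ => C * (∫ y in Ico (0 : ℝ) 1, |g y|) * (β⁻¹ * ‖l‖) ^ m₂)
      atTop (𝓝 0) := by
    simpa using (tendsto_pow_atTop_nhds_zero_of_lt_one (by positivity) hρ).const_mul
      (C * ∫ y in Ico (0 : ℝ) 1, |g y|)
  have hsmall := (tendsto_sub_atTop_nat m₁).eventually (hlim.eventually_lt_const (half_pos hε))
  filter_upwards [hsmall, eventually_ge_atTop m₁] with m hm hm₁m x hx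
  obtain ⟨m₂, rfl⟩ := Nat.exists_eq_add_of_le hm₁m
  rw [Nat.add_sub_cancel_left] at hm
  have hgi : IntegrableOn g (Ico 0 1) := hg.integrableOn_Icc.mono_set Ico_subset_Icc_self
  have hbound := hrate g hgi m₁ m₂ E hE.le hosc x hx
  rw [div_mul_cancel₀ _ (pow_pos hβ n).ne'] at hbound
  simpa using hbound.trans_lt (by linarith)

theorem tendsto_integral_abs_transferError (hM : IsMultinacci n β) (hl : IsSecondRoot n l)
    (hf : IntegrableOn f (Ico 0 1)) :
    Tendsto (fun m => ∫ x in Ico (0 : ℝ) 1, |transferError n β m f x|) atTop (𝓝 0) := by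
  refine tendsto_order.2 ⟨fun a ha => .of_forall fun m =>
    ha.trans_le (integral_nonneg fun _ => abs_nonneg _), fun ε hε => ?_⟩
  obtain ⟨g, -, hfg, hgc, hg⟩ :=
    Integrable.exists_hasCompactSupport_integral_sub_le hf (by positivity : (0 : ℝ) < ε / 4)
  have hunif := Metric.tendstoUniformlyOn_iff.1
    (hM.tendstoUniformlyOn_transferError hl hgc.continuousOn) (ε / 4) (by positivity)
  filter_upwards [hunif] with m hm
  have hsub : IntegrableOn (f - g) (Ico 0 1) := Integrable.sub hf hg
  have hgm : ∫ x in Ico (0 : ℝ) 1, |transferError n β m g x| ≤ ε / 4 := by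
    simpa using setIntegral_mono_on (hM.integrableOn_transferError hg m).abs
      (integrable_const (ε / 4)) measurableSet_Ico fun x hx => by simpa using (hm x hx).le
  calc ∫ x in Ico (0 : ℝ) 1, |transferError n β m f x|
      ≤ ∫ x in Ico (0 : ℝ) 1, (|transferError n β m (f - g) x| + |transferError n β m g x|) := by
        refine integral_mono (hM.integrableOn_transferError hf m).abs (Integrable.add
          (hM.integrableOn_transferError hsub m).abs (hM.integrableOn_transferError hg m).abs)
          fun x => ?_
        simpa [transferError_sub n β m hf hg] using
          abs_add_le (transferError n β m (f - g) x) (transferError n β m g x)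
    _ = (∫ x in Ico (0 : ℝ) 1, |transferError n β m (f - g) x|) +
        ∫ x in Ico (0 : ℝ) 1, |transferError n β m g x| :=
        integral_add (hM.integrableOn_transferError hsub m).abs
          (hM.integrableOn_transferError hg m).abs
    _ ≤ 2 * (ε / 4) + ε / 4 :=
        add_le_add ((hM.integral_abs_transferError_le hsub m).trans (by gcongr; exact hfg)) hgm
    _ < ε := by linarith

lemma tendsto_tvDist_iterate_transfer (hM : IsMultinacci n β) (hl : IsSecondRoot n l)
    (hf : IsPDF f) :
    Tendsto (fun m => tvDist (densityLaw ((transfer β)^[m] f)) (densityLaw (parryDensity n β)))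
      atTop (𝓝 0) := by
  refine tendsto_tvDist_of_tendsto_integral (isPDF_iterate_transfer hM.pos hM.le_two hf)
    hM.isPDF_parryDensity ?_
  simpa [transferError, hf.integral_eq_one] using
    hM.tendsto_integral_abs_transferError hl hf.integrableOn

end IsMultinacci

end Convergence

end

end PseudoGolden

theorem theorem1_general (n : ℕ) (hn : 2 ≤ n) (β : ℝ) (hβ_pos : 0 < β)
    (hβ : β ^ n = ∑ i ∈ Finset.range n, β ^ i) (lam₂ : ℂ) (hlam₂ : IsSecondRoot n lam₂) :
    (∀ x ∈ Ico (0 : ℝ) 1, ∀ m : ℕ,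
      HasSum (fun k : ℕ => (digit β (m + k) x : ℝ) * (β ^ (k + 1))⁻¹) ((betaMap β)^[m] x)) ∧
    IsPDF (parryDensity n β) ∧
    MeasurePreserving (betaMap β) (densityLaw (parryDensity n β))
      (densityLaw (parryDensity n β)) ∧
    (∀ (Ω : Type*) [MeasurableSpace Ω] (P : Measure Ω) (X : Ω → ℝ) (f : ℝ → ℝ),
      IsPDF f → HasLaw X (densityLaw f) P →
      (∀ m : ℕ, IsPDF ((transfer β)^[m] f) ∧
        HasLaw (fun ω => (betaMap β)^[m] (X ω)) (densityLaw ((transfer β)^[m] f)) P) ∧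
      Tendsto (fun m : ℕ => tvDist (P.map fun ω => (betaMap β)^[m] (X ω))
        (densityLaw (parryDensity n β))) atTop (𝓝 0)) ∧
    (∃ C₁ C₂ : ℝ, ∀ (f : ℝ → ℝ) (L : ℝ),
      (∀ x ∈ Ico (0 : ℝ) 1, ∀ y ∈ Ico (0 : ℝ) 1, |f x - f y| ≤ L * |x - y|) →
      ∀ m₁ m₂ : ℕ, ∀ x ∈ Ico (0 : ℝ) 1,
        |(transfer β)^[m₁ + m₂] f x - (∫ y in Ico (0 : ℝ) 1, f y) * parryDensity n β x| ≤
          C₁ * (∫ y in Ico (0 : ℝ) 1, |f y|) * ‖(β : ℂ)⁻¹ * lam₂‖ ^ m₂ +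
            C₂ * (β ^ m₁)⁻¹ * L) := by
  have hM : IsMultinacci n β := ⟨hn, hβ_pos, hβ⟩
  refine ⟨fun x hx m => hasSum_digit hM.one_lt hx m, hM.isPDF_parryDensity,
    hM.measurePreserving_parryDensity, fun Ω _ P X f hf hX => ?_, ?_⟩
  · have hlaw (m : ℕ) :
        HasLaw (fun ω => (betaMap β)^[m] (X ω)) (densityLaw ((transfer β)^[m] f)) P :=
      (measurePreserving_iterate_betaMap hM.pos hM.le_two hf m).fun_comp_hasLaw hX
    refine ⟨fun m => ⟨isPDF_iterate_transfer hM.pos hM.le_two hf m, hlaw m⟩, ?_⟩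
    simpa only [(hlaw _).map_eq] using hM.tendsto_tvDist_iterate_transfer hlam₂ hf
  · have hnorm : ‖(β : ℂ)⁻¹ * lam₂‖ = β⁻¹ * ‖lam₂‖ := by
      rw [norm_mul, norm_inv, Complex.norm_of_nonneg hβ_pos.le]
    rw [hnorm]
    exact hM.exists_abs_transferError_le_of_lipschitz hlam₂

theorem theorem1 (n : ℕ) (hn : 2 ≤ n) (β : ℝ) (hβ_pos : 0 < β)
    (hβ : β ^ n = ∑ i ∈ Finset.range n, β ^ i)
    (lam₂ : ℂ) (hlam₂ : IsSecondRoot n lam₂) :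
    -- the scaled remainder `t^m(x)` is the series of the shifted digits
    (∀ x ∈ Ico (0 : ℝ) 1, ∀ m : ℕ,
      HasSum (fun k : ℕ => (digit β (m + k) x : ℝ) * (β ^ (k + 1))⁻¹) ((betaMap β)^[m] x)) ∧
    -- `f_β` is a probability density, and its law `P_β` is invariant under `t`
    IsPDF (parryDensity n β) ∧
    MeasurePreserving (betaMap β) (densityLaw (parryDensity n β))
      (densityLaw (parryDensity n β)) ∧
    -- `f_m = T^m f` is a density of `t^m(X)`, and the law of `t^m(X)` converges to `P_β`
    (∀ (Ω : Type*) [MeasurableSpace Ω] (P : Measure Ω) [IsProbabilityMeasure P]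
      (X : Ω → ℝ) (f : ℝ → ℝ), IsPDF f → HasLaw X (densityLaw f) P →
      (∀ m : ℕ, IsPDF ((transfer β)^[m] f) ∧
        HasLaw (fun ω => (betaMap β)^[m] (X ω)) (densityLaw ((transfer β)^[m] f)) P) ∧
      Tendsto (fun m : ℕ => tvDist (P.map fun ω => (betaMap β)^[m] (X ω))
        (densityLaw (parryDensity n β))) atTop (𝓝 0)) ∧
    -- the rate for Lipschitz densities, with constants that depend only on `n`
    (∃ C₁ C₂ : ℝ, ∀ (f : ℝ → ℝ) (L : ℝ), IsPDF f →
      (∀ x ∈ Ico (0 : ℝ) 1, ∀ y ∈ Ico (0 : ℝ) 1, |f x - f y| ≤ L * |x - y|) →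
      ∀ m m₁ m₂ : ℕ, m₁ + m₂ = m → 2 * n - 1 < m₂ → n - 1 ≤ m₁ →
        ∀ x ∈ Ico (0 : ℝ) 1,
          |(transfer β)^[m] f x - parryDensity n β x| ≤
            C₁ * ‖(β : ℂ)⁻¹ * lam₂‖ ^ m₂ + C₂ * (β ^ m₁)⁻¹ * L) := by
  obtain ⟨hdig, hpdf, hinv, hconv, C₁, C₂, hrate⟩ := theorem1_general n hn β hβ_pos hβ lam₂ hlam₂
  exact ⟨hdig, hpdf, hinv, fun Ω _ P _ => hconv Ω P, C₁, C₂, fun f L hf hL m m₁ m₂ hm _ _ x hx => by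
    simpa [hf.integral_eq_one, hf.integral_abs_eq_one, ← hm] using hrate f L hL m₁ m₂ x hx⟩
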